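/- A $3\times3$ magilatin square with magic sum $t$ is a $3\times3$ array of positive integers in which every row and every column has sum $t$ and the entries within each row and within each column are distinct (entries in different rows and columns may be equal). A reduced magilatin square satisfies the same conditions except that its entries are nonnegative with smallest entry $0$. Two squares have the same symmetry type if one is obtained from the other by permuting rows, permuting columns and reflecting in the main diagonal. For $t>0$ let $L_a(t)$ be the number of magilatin squares with magic sum $t$ and $\hat L_a(t)$ the number of their symmetry types; let $R(s)$, $\hat R(s)$ be the corresponding numbers of reduced squares, and of symmetry types of reduced squares, with magic sum $s>0$. Write $\mathbf f(x)=\sum_{t>0}f(t)x^t$ for the generating function of $f$. A function $f$ of $t>0$ is a quasipolynomial if there are $p\ge1$ and polynomials $f_0,\dots,f_{p-1}$ with $f(t)=f_{t\bmod p}(t)$ for all $t>0$; its period is the least such $p$, the $f_i$ are then its constituents, and $f_0$ is its principal constituent. Let $$S_7(t)=\Big\lfloor\frac{t-1}{21}\Big\rfloor+\begin{cases}1,& t\equiv 10,13,16,17,19,20 \pmod{21},\\ 0,&\text{otherwise.}\end{cases}$$ **(1) All squares.** The generating function is $$\mathbf L_a(x)=\frac{x^3}{1-x^3}\,\mathbf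 R(x)=\frac{12x^6\,p(x)}{(1+x)(1+x+x^2)(1+x^2)(1-x^3)(1-x^5)(1-x^6)(1-x^7)(1-x^8)},$$ where $$p(x)=1+3x+7x^{2}+15x^{3}+33x^{4}+65x^{5}+128x^{6}+208x^{7}+316x^{8}+434x^{9}+566x^{10}+676x^{11}+784x^{12}+852x^{13}+911x^{14}+936x^{15}+967x^{16}+967x^{17}+1001x^{18}+995x^{19}+1000x^{20}+955x^{21}+893x^{22}+752x^{23}+624x^{24}+456x^{25}+322x^{26}+174x^{27}+79x^{28}.$$ $L_a$ is a quasipolynomial of period $840$, all of whose constituents have degree $4$. For all $t>0$, $$L_a(t)=\tfrac18t^4-3t^3+a_2(t)t^2-a_1(t)t+a_0(t)-72S_7(t),$$ where $a_2,a_1,a_0$ are periodic with (minimal) periods $6$, $12$, $120$, respectively, with $$a_2(t)=\begin{cases}\tfrac{151}{4}, & t\equiv 0\\ \tfrac{63}{2}, & t\equiv 1,5\\ \tfrac{135}{4}, & t\equiv 2,4\\ \tfrac{71}{2}, & t\equiv 3\end{cases}\pmod{6},$$ $$a_1(t)=\begin{cases}\tfrac{1296}{5}, & t\equiv 0\\ \tfrac{1347}{10},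 & t\equiv 1,5\\ \tfrac{831}{5}, & t\equiv 2,10\\ \tfrac{2097}{10}, & t\equiv 3\\ \tfrac{876}{5}, & t\equiv 4,8\\ \tfrac{1251}{5}, & t\equiv 6\\ \tfrac{1257}{10}, & t\equiv 7,11\\ \tfrac{2187}{10}, & t\equiv 9\end{cases}\pmod{12},$$ and $a_0(t)$ given, for $t$ modulo $120$ in increasing order, by - $t\equiv 0,\dots,9$: $876,\ \tfrac{4243}{40},\ \tfrac{1097}{5},\ \tfrac{15219}{40},\ \tfrac{1604}{5},\ \tfrac{1463}{8},\ \tfrac{3201}{5},\ \tfrac{3091}{40},\ \tfrac{1448}{5},\ \tfrac{21267}{40}$ - $t\equiv 10,\dots,19$: $265,\ -\tfrac{1037}{40},\ \tfrac{4092}{5},\ \tfrac{4819}{40},\ \tfrac{809}{5},\ \tfrac{4023}{8},\ \tfrac{1676}{5},\ \tfrac{5011}{40},\ \tfrac{3273}{5},\ \tfrac{787}{40}$ - $t\equiv 20,\dots,29$: $340,\ \tfrac{21843}{40},\ \tfrac{1037}{5},\ -\tfrac{461}{40},\ \tfrac{4164}{5},\ \tfrac{1367}{8},\ \tfrac{881}{5},\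 \tfrac{17811}{40},\ \tfrac{1388}{5},\ \tfrac{5587}{40}$ - $t\equiv 30,\dots,39$: $705,\ \tfrac{1363}{40},\ \tfrac{1772}{5},\ \tfrac{19539}{40},\ \tfrac{1109}{5},\ \tfrac{311}{8},\ \tfrac{3876}{5},\ \tfrac{7411}{40},\ \tfrac{593}{5},\ \tfrac{18387}{40}$ - $t\equiv 40,\dots,49$: $400,\ \tfrac{3283}{40},\ \tfrac{3597}{5},\ -\tfrac{941}{40},\ \tfrac{1484}{5},\ \tfrac{4887}{8},\ \tfrac{821}{5},\ \tfrac{2131}{40},\ \tfrac{3948}{5},\ \tfrac{5107}{40}$ - $t\equiv 50,\dots,59$: $241,\ \tfrac{16083}{40},\ \tfrac{1712}{5},\ \tfrac{3859}{40},\ \tfrac{3309}{5},\ \tfrac{791}{8},\ \tfrac{1556}{5},\ \tfrac{22131}{40},\ \tfrac{893}{5},\ -\tfrac{173}{40}$ - $t\equiv 60,\dots,69$: $840,\ \tfrac{5683}{40},\ \tfrac{917}{5},\ \tfrac{16659}{40},\ \tfrac{1784}{5},\ \tfrac{1175}{8},\ \tfrac{3381}{5},\ \tfrac{1651}{40},\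 \tfrac{1268}{5},\ \tfrac{22707}{40}$ - $t\equiv 70,\dots,79$: $229,\ \tfrac{403}{40},\ \tfrac{4272}{5},\ \tfrac{3379}{40},\ \tfrac{989}{5},\ \tfrac{3735}{8},\ \tfrac{1496}{5},\ \tfrac{6451}{40},\ \tfrac{3093}{5},\ \tfrac{2227}{40}$ - $t\equiv 80,\dots,89$: $376,\ \tfrac{20403}{40},\ \tfrac{1217}{5},\ -\tfrac{1901}{40},\ \tfrac{3984}{5},\ \tfrac{1655}{8},\ \tfrac{701}{5},\ \tfrac{19251}{40},\ \tfrac{1568}{5},\ \tfrac{4147}{40}$ - $t\equiv 90,\dots,99$: $741,\ -\tfrac{77}{40},\ \tfrac{1592}{5},\ \tfrac{20979}{40},\ \tfrac{929}{5},\ \tfrac{599}{8},\ \tfrac{4056}{5},\ \tfrac{5971}{40},\ \tfrac{773}{5},\ \tfrac{16947}{40}$ - $t\equiv 100,\dots,109$: $364,\ \tfrac{4723}{40},\ \tfrac{3417}{5},\ \tfrac{499}{40},\ \tfrac{1664}{5},\ \tfrac{4599}{8},\ \tfrac{1001}{5},\ \tfrac{691}{40},\ \tfrac{3768}{5},\ \tfrac{6547}{40}$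 - $t\equiv 110,\dots,119$: $205,\ \tfrac{17523}{40},\ \tfrac{1892}{5},\ \tfrac{2419}{40},\ \tfrac{3489}{5},\ \tfrac{503}{8},\ \tfrac{1376}{5},\ \tfrac{23571}{40},\ \tfrac{713}{5},\ \tfrac{1267}{40}$ The principal constituent of $L_a$ is $\frac18t^4-3t^3+\frac{151}4t^2-\frac{9192}{35}t+948$. **(2) Symmetry types.** The generating function is $$\hat{\mathbf L}_a(x)=\frac{x^3}{1-x^3}\,\hat{\mathbf R}(x)=\frac{x^6\,\hat p(x)}{(1+x)(1+x+x^2)(1+x^2)(1-x^3)(1-x^5)(1-x^6)(1-x^7)(1-x^8)},$$ where $$\hat p(x)=1+3x+7x^{2}+13x^{3}+23x^{4}+37x^{5}+60x^{6}+86x^{7}+118x^{8}+149x^{9}+180x^{10}+199x^{11}+212x^{12}+208x^{13}+196x^{14}+171x^{15}+145x^{16}+115x^{17}+96x^{18}+79x^{19}+72x^{20}+67x^{21}+66x^{22}+59x^{23}+54x^{24}+43x^{25}+33x^{26}+19x^{27}+9x^{28}.$$ $\hat L_a$ is a quasipolynomial of period $840$, all of whose constituents have degree $4$. For all $t>0$,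 $$\hat L_a(t)=\tfrac1{576}t^4-\tfrac1{48}t^3+\hat a_2(t)t^2-\hat a_1(t)t+\hat a_0(t)-S_7(t),$$ where $\hat a_2,\hat a_1,\hat a_0$ are periodic with (minimal) periods $6$, $12$, $120$, respectively, with $$\hat a_2(t)=\begin{cases}\tfrac{25}{96}, & t\equiv 0\\ \tfrac{25}{144}, & t\equiv 1,5\\ \tfrac{59}{288}, & t\equiv 2,4\\ \tfrac{11}{48}, & t\equiv 3\end{cases}\pmod{6},$$ $$\hat a_1(t)=\begin{cases}\tfrac{31}{15}, & t\equiv 0\\ \tfrac{103}{120}, & t\equiv 1,5\\ \tfrac{133}{120}, & t\equiv 2,10\\ \tfrac{47}{30}, & t\equiv 3\\ \tfrac{37}{30}, & t\equiv 4,8\\ \tfrac{233}{120}, & t\equiv 6\\ \tfrac{11}{15}, & t\equiv 7,11\\ \tfrac{203}{120}, & t\equiv 9\end{cases}\pmod{12},$$ and $\hat a_0(t)$ given, for $t$ modulo $120$ in increasing order, by - $t\equiv 0,\dots,9$: $8,\ \tfrac{2027}{2880},\ \tfrac{553}{360},\ \tfrac{979}{320},\ \tfrac{229}{90},\ \tfrac{847}{576},\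 \tfrac{221}{40},\ \tfrac{1739}{2880},\ \tfrac{104}{45},\ \tfrac{1427}{320}$ - $t\equiv 10,\dots,19$: $\tfrac{149}{72},\ -\tfrac{1813}{2880},\ \tfrac{73}{10},\ \tfrac{2891}{2880},\ \tfrac{301}{360},\ \tfrac{279}{64},\ \tfrac{128}{45},\ \tfrac{2219}{2880},\ \tfrac{233}{40},\ -\tfrac{277}{2880}$ - $t\equiv 20,\dots,29$: $\tfrac{47}{18},\ \tfrac{1523}{320},\ \tfrac{493}{360},\ -\tfrac{949}{2880},\ \tfrac{38}{5},\ \tfrac{751}{576},\ \tfrac{409}{360},\ \tfrac{1171}{320},\ \tfrac{193}{90},\ \tfrac{3083}{2880}$ - $t\equiv 30,\dots,39$: $\tfrac{49}{8},\ \tfrac{587}{2880},\ \tfrac{131}{45},\ \tfrac{1299}{320},\ \tfrac{601}{360},\ -\tfrac{17}{576},\ \tfrac{69}{10},\ \tfrac{4619}{2880},\ \tfrac{157}{360},\ \tfrac{1267}{320}$ - $t\equiv 40,\dots,49$: $\tfrac{31}{9},\ \tfrac{1067}{2880},\ \tfrac{257}{40},\ -\tfrac{1429}{2880},\ \tfrac{199}{90},\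 \tfrac{343}{64},\ \tfrac{349}{360},\ \tfrac{779}{2880},\ \tfrac{36}{5},\ \tfrac{2603}{2880}$ - $t\equiv 50,\dots,59$: $\tfrac{125}{72},\ \tfrac{1043}{320},\ \tfrac{247}{90},\ \tfrac{1931}{2880},\ \tfrac{229}{40},\ \tfrac{463}{576},\ \tfrac{113}{45},\ \tfrac{1491}{320},\ \tfrac{457}{360},\ -\tfrac{1237}{2880}$ - $t\equiv 60,\dots,69$: $\tfrac{15}{2},\ \tfrac{3467}{2880},\ \tfrac{373}{360},\ \tfrac{1139}{320},\ \tfrac{137}{45},\ \tfrac{559}{576},\ \tfrac{241}{40},\ \tfrac{299}{2880},\ \tfrac{163}{90},\ \tfrac{1587}{320}$ - $t\equiv 70,\dots,79$: $\tfrac{113}{72},\ -\tfrac{373}{2880},\ \tfrac{39}{5},\ \tfrac{1451}{2880},\ \tfrac{481}{360},\ \tfrac{247}{64},\ \tfrac{211}{90},\ \tfrac{3659}{2880},\ \tfrac{213}{40},\ \tfrac{1163}{2880}$ - $t\equiv 80,\dots,89$: $\tfrac{28}{9},\ \tfrac{1363}{320},\ \tfrac{673}{360},\ -\tfrac{2389}{2880},\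 \tfrac{71}{10},\ \tfrac{1039}{576},\ \tfrac{229}{360},\ \tfrac{1331}{320},\ \tfrac{119}{45},\ \tfrac{1643}{2880}$ - $t\equiv 90,\dots,99$: $\tfrac{53}{8},\ -\tfrac{853}{2880},\ \tfrac{217}{90},\ \tfrac{1459}{320},\ \tfrac{421}{360},\ \tfrac{271}{576},\ \tfrac{37}{5},\ \tfrac{3179}{2880},\ \tfrac{337}{360},\ \tfrac{1107}{320}$ - $t\equiv 100,\dots,109$: $\tfrac{53}{18},\ \tfrac{2507}{2880},\ \tfrac{237}{40},\ \tfrac{11}{2880},\ \tfrac{122}{45},\ \tfrac{311}{64},\ \tfrac{529}{360},\ -\tfrac{661}{2880},\ \tfrac{67}{10},\ \tfrac{4043}{2880}$ - $t\equiv 110,\dots,119$: $\tfrac{89}{72},\ \tfrac{1203}{320},\ \tfrac{146}{45},\ \tfrac{491}{2880},\ \tfrac{249}{40},\ \tfrac{175}{576},\ \tfrac{181}{90},\ \tfrac{1651}{320},\ \tfrac{277}{360},\ \tfrac{203}{2880}$ The principal constituent of $\hat L_a$ is $\frac1{576}t^4-\frac1{48}t^3+\frac{25}{96}t^2-\frac{74}{35}t+9$.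 -/

import Mathlib

namespace Magilatin

/-- `3 × 3` squares with nonnegative integral entries. -/
abbrev Square : Type := Matrix (Fin 3) (Fin 3) ℕ

/-- All row sums and all column sums are equal to `t` (`t` is the magic sum). -/
def HasMagicSum (x : Square) (t : ℕ) : Prop :=
  (∀ j, ∑ k, x j k = t) ∧ (∀ k, ∑ j, x j k = t)

/-- The entries within each row are distinct, and so are the entries within each column. -/
def LineDistinct (x : Square) : Prop :=
  (∀ j, Function.Injective fun k => x j k) ∧ (∀ k, Function.Injective fun j => x j k)

/-- The magilatin squares with magic sum `t`: all entries are positive. -/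
def magilatinSquares (t : ℕ) : Set Square :=
  {x | (∀ j k, 0 < x j k) ∧ HasMagicSum x t ∧ LineDistinct x}

/-- The reduced magilatin squares with magic sum `s`: the smallest entry is `0`. -/
def reducedSquares (s : ℕ) : Set Square :=
  {x | (∃ j k, x j k = 0) ∧ HasMagicSum x s ∧ LineDistinct x}

/-- Two squares are of the same symmetry type if one is obtained from the other by a permutation
of the rows and a permutation of the columns, possibly combined with the reflection in the
main diagonal. -/
def SameType (x y : Square) : Prop :=
  ∃ σ τ : Equiv.Perm (Fin 3), y = x.submatrix σ τ ∨ y = x.transpose.submatrix σ τ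

theorem sameType_equivalence : Equivalence SameType where
  refl x := ⟨1, 1, Or.inl (by ext j k; rfl)⟩
  symm := by
    rintro x y ⟨σ, τ, h | h⟩
    · exact ⟨σ⁻¹, τ⁻¹, Or.inl (by subst h; ext j k; simp)⟩
    · exact ⟨τ⁻¹, σ⁻¹, Or.inr (by subst h; ext j k; simp)⟩
  trans := by
    rintro x y z ⟨σ, τ, h | h⟩ ⟨σ', τ', h' | h'⟩
    · exact ⟨σ * σ', τ * τ', Or.inl (by subst h; subst h'; ext j k; simp)⟩
    · exact ⟨τ * σ', σ * τ', Or.inr (by subst h; subst h'; ext j k; simp)⟩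
    · exact ⟨σ * σ', τ * τ', Or.inr (by subst h; subst h'; ext j k; simp)⟩
    · exact ⟨τ * σ', σ * τ', Or.inl (by subst h; subst h'; ext j k; simp)⟩

/-- Equality of symmetry types, as a setoid on a given set of squares. -/
def typeSetoid (S : Set Square) : Setoid S where
  r x y := SameType x.1 y.1
  iseqv := ⟨fun x => sameType_equivalence.refl x.1, fun h => sameType_equivalence.symm h,
    fun h h' => sameType_equivalence.trans h h'⟩

/-- The number of symmetry types represented in a set of squares. -/
noncomputable def typeCount (S : Set Square) : ℕ := Nat.card (Quotient (typeSetoid S))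

/-- The number of magilatin squares with magic sum `t`. -/
noncomputable def L (t : ℕ) : ℕ := (magilatinSquares t).ncard

/-- The number of symmetry types of magilatin squares with magic sum `t`. -/
noncomputable def hatL (t : ℕ) : ℕ := typeCount (magilatinSquares t)

/-- The number of reduced magilatin squares with magic sum `s`. -/
noncomputable def R (s : ℕ) : ℕ := (reducedSquares s).ncard

/-- The number of symmetry types of reduced magilatin squares with magic sum `s`. -/
noncomputable def hatR (s : ℕ) : ℕ := typeCount (reducedSquares s)

/-- The generating function `∑_{t > 0} f(t) x ^ t`. -/
noncomputable def genFun (f : ℕ → ℕ) : PowerSeries ℚ :=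
  PowerSeries.mk fun t => if t = 0 then 0 else (f t : ℚ)

/-- The numerator factor in braces of the generating function of `L`. -/
noncomputable def numL (x : PowerSeries ℚ) : PowerSeries ℚ :=
  1 + 3 * x + 7 * x ^ 2 + 15 * x ^ 3 + 33 * x ^ 4 + 65 * x ^ 5 + 128 * x ^ 6 + 208 * x ^ 7 +
    316 * x ^ 8 + 434 * x ^ 9 + 566 * x ^ 10 + 676 * x ^ 11 + 784 * x ^ 12 + 852 * x ^ 13 + 911 * x ^ 14 + 936 * x ^ 15 +
    967 * x ^ 16 + 967 * x ^ 17 + 1001 * x ^ 18 + 995 * x ^ 19 + 1000 * x ^ 20 + 955 * x ^ 21 + 893 * x ^ 22 + 752 * x ^ 23 +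
    624 * x ^ 24 + 456 * x ^ 25 + 322 * x ^ 26 + 174 * x ^ 27 + 79 * x ^ 28

/-- The numerator factor in braces of the generating function of `hatL`. -/
noncomputable def numHatL (x : PowerSeries ℚ) : PowerSeries ℚ :=
  1 + 3 * x + 7 * x ^ 2 + 13 * x ^ 3 + 23 * x ^ 4 + 37 * x ^ 5 + 60 * x ^ 6 + 86 * x ^ 7 +
    118 * x ^ 8 + 149 * x ^ 9 + 180 * x ^ 10 + 199 * x ^ 11 + 212 * x ^ 12 + 208 * x ^ 13 + 196 * x ^ 14 + 171 * x ^ 15 +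
    145 * x ^ 16 + 115 * x ^ 17 + 96 * x ^ 18 + 79 * x ^ 19 + 72 * x ^ 20 + 67 * x ^ 21 + 66 * x ^ 22 + 59 * x ^ 23 +
    54 * x ^ 24 + 43 * x ^ 25 + 33 * x ^ 26 + 19 * x ^ 27 + 9 * x ^ 28

/-- The common denominator of the two generating functions. -/
noncomputable def den (x : PowerSeries ℚ) : PowerSeries ℚ :=
  (1 + x) * (1 + x + x ^ 2) * (1 + x ^ 2) * (1 - x ^ 3) * (1 - x ^ 5) * (1 - x ^ 6) *
    (1 - x ^ 7) * (1 - x ^ 8)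

/-- `N 0, …, N (p - 1)` are polynomials with `f t = N (t mod p) (t)` for all `t > 0`. -/
def IsConstituents (f : ℕ → ℚ) (p : ℕ) (N : ℕ → Polynomial ℚ) : Prop :=
  ∀ t : ℕ, 0 < t → f t = (N (t % p)).eval (t : ℚ)

/-- `f`, as a function of `t > 0`, is a quasipolynomial whose period, that is, the minimal number
of constituents, is `p`. -/
def HasPeriod (f : ℕ → ℚ) (p : ℕ) : Prop :=
  IsLeast {q : ℕ | 0 < q ∧ ∃ N : ℕ → Polynomial ℚ, IsConstituents f q N} p

/-- The correction term `S₇`. -/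
def S7 (t : ℕ) : ℤ :=
  ⌊((t : ℚ) - 1) / 21⌋ +
    if t % 21 = 10 ∨ t % 21 = 13 ∨ t % 21 = 16 ∨ t % 21 = 17 ∨ t % 21 = 19 ∨ t % 21 = 20
    then 1 else 0

/-- The quadratic coefficient of `L`. -/
def a2 (t : ℕ) : ℚ :=
  if t % 6 = 0 then 151/4
  else if t % 6 = 1 ∨ t % 6 = 5 then 63/2
  else if t % 6 = 2 ∨ t % 6 = 4 then 135/4
  else 71/2

/-- The negative of the linear coefficient of the truncated constituents of `L`. -/
def a1 (t : ℕ) : ℚ :=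
  if t % 12 = 0 then 1296/5
  else if t % 12 = 1 ∨ t % 12 = 5 then 1347/10
  else if t % 12 = 2 ∨ t % 12 = 10 then 831/5
  else if t % 12 = 3 then 2097/10
  else if t % 12 = 4 ∨ t % 12 = 8 then 876/5
  else if t % 12 = 6 then 1251/5
  else if t % 12 = 7 ∨ t % 12 = 11 then 1257/10
  else 2187/10

/-- The constant terms `a₀(0), …, a₀(119)` of the truncated constituents of `L`. -/
def a0Table : List ℚ :=
  [876, 4243/40, 1097/5, 15219/40, 1604/5, 1463/8, 3201/5, 3091/40, 1448/5, 21267/40,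
    265, -1037/40, 4092/5, 4819/40, 809/5, 4023/8, 1676/5, 5011/40, 3273/5, 787/40,
    340, 21843/40, 1037/5, -461/40, 4164/5, 1367/8, 881/5, 17811/40, 1388/5, 5587/40,
    705, 1363/40, 1772/5, 19539/40, 1109/5, 311/8, 3876/5, 7411/40, 593/5, 18387/40,
    400, 3283/40, 3597/5, -941/40, 1484/5, 4887/8, 821/5, 2131/40, 3948/5, 5107/40,
    241, 16083/40, 1712/5, 3859/40, 3309/5, 791/8, 1556/5, 22131/40, 893/5, -173/40,
    840, 5683/40, 917/5, 16659/40, 1784/5, 1175/8, 3381/5, 1651/40, 1268/5, 22707/40,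
    229, 403/40, 4272/5, 3379/40, 989/5, 3735/8, 1496/5, 6451/40, 3093/5, 2227/40,
    376, 20403/40, 1217/5, -1901/40, 3984/5, 1655/8, 701/5, 19251/40, 1568/5, 4147/40,
    741, -77/40, 1592/5, 20979/40, 929/5, 599/8, 4056/5, 5971/40, 773/5, 16947/40,
    364, 4723/40, 3417/5, 499/40, 1664/5, 4599/8, 1001/5, 691/40, 3768/5, 6547/40,
    205, 17523/40, 1892/5, 2419/40, 3489/5, 503/8, 1376/5, 23571/40, 713/5, 1267/40]

/-- The constant term of the truncated constituents of `L`. -/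
def a0 (t : ℕ) : ℚ := a0Table.getD (t % 120) 0

/-- The quadratic coefficient of `hatL`. -/
def hatA2 (t : ℕ) : ℚ :=
  if t % 6 = 0 then 25/96
  else if t % 6 = 1 ∨ t % 6 = 5 then 25/144
  else if t % 6 = 2 ∨ t % 6 = 4 then 59/288
  else 11/48

/-- The negative of the linear coefficient of the truncated constituents of `hatL`. -/
def hatA1 (t : ℕ) : ℚ :=
  if t % 12 = 0 then 31/15
  else if t % 12 = 1 ∨ t % 12 = 5 then 103/120
  else if t % 12 = 2 ∨ t % 12 = 10 then 133/120
  else if t % 12 = 3 then 47/30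
  else if t % 12 = 4 ∨ t % 12 = 8 then 37/30
  else if t % 12 = 6 then 233/120
  else if t % 12 = 7 ∨ t % 12 = 11 then 11/15
  else 203/120

/-- The constant terms `â₀(0), …, â₀(119)` of the truncated constituents of `hatL`. -/
def hatA0Table : List ℚ :=
  [8, 2027/2880, 553/360, 979/320, 229/90, 847/576, 221/40, 1739/2880, 104/45, 1427/320,
    149/72, -1813/2880, 73/10, 2891/2880, 301/360, 279/64, 128/45, 2219/2880, 233/40, -277/2880,
    47/18, 1523/320, 493/360, -949/2880, 38/5, 751/576, 409/360, 1171/320, 193/90, 3083/2880,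
    49/8, 587/2880, 131/45, 1299/320, 601/360, -17/576, 69/10, 4619/2880, 157/360, 1267/320,
    31/9, 1067/2880, 257/40, -1429/2880, 199/90, 343/64, 349/360, 779/2880, 36/5, 2603/2880,
    125/72, 1043/320, 247/90, 1931/2880, 229/40, 463/576, 113/45, 1491/320, 457/360, -1237/2880,
    15/2, 3467/2880, 373/360, 1139/320, 137/45, 559/576, 241/40, 299/2880, 163/90, 1587/320,
    113/72, -373/2880, 39/5, 1451/2880, 481/360, 247/64, 211/90, 3659/2880, 213/40, 1163/2880,
    28/9, 1363/320, 673/360, -2389/2880, 71/10, 1039/576, 229/360, 1331/320, 119/45, 1643/2880,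
    53/8, -853/2880, 217/90, 1459/320, 421/360, 271/576, 37/5, 3179/2880, 337/360, 1107/320,
    53/18, 2507/2880, 237/40, 11/2880, 122/45, 311/64, 529/360, -661/2880, 67/10, 4043/2880,
    89/72, 1203/320, 146/45, 491/2880, 249/40, 175/576, 181/90, 1651/320, 277/360, 203/2880]

/-- The constant term of the truncated constituents of `hatL`. -/
def hatA0 (t : ℕ) : ℚ := hatA0Table.getD (t % 120) 0

end Magilatin

set_option linter.unusedSimpArgs false

namespace Magilatin

/-! Every symmetry type has exactly one representative in normal form: a smallest entry in the
corner, the rest of the first row and of the first column increasing, and entry `(0, 1)` at most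
entry `(1, 0)`. After the corner is subtracted, the sum conditions leave four free parameters `(d,
g, f, e)`, and the squares become the lattice points of the orthant with `e ≥ 1` that avoid seven
hyperplanes (`IsNormal.exists_shift_square`). So symmetry types of reduced squares are counted by
cutting this complement into 25 half-open unimodular simplicial cones, each contributing `X ^ k / ∏
(1 - X ^ aᵢ)` (`weightGF_admissible`).

To count squares instead of types, each point is weighted by the size of its orbit under the group
of order 72. The orbit has 72 elements generically, 36 if exactly one of `f`, `g`, `d` vanishes, and
12 for the Latin squares `f = g = 0`; the other double vanishings are excluded. The case checks
`submatrix_shift_square` and `transpose_submatrix_shift_square` give both the uniqueness of the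
normal form and the stabilizers, and `weightGF_weighted_eq_genFun` assembles the count. Subtracting
1 from every entry gives `L (t + 3) = R t + L t`, hence the factor `X ^ 3 / (1 - X ^ 3)`.

The explicit formulas are then verified rather than derived. Multiplication by the denominator is
injective on power series, so it suffices that the proposed quasipolynomial, multiplied by the
denominator, yields the numerator. Away from its first coefficients this product obeys a fixed
linear recurrence, which reduces its vanishing to finitely many values (`eq_of_genFun`). Minimality
of a period `P` needs only a comparison of constituents `P / r` apart, for each prime `r` dividing
`P` (`hasPeriod_of_forall_prime`). -/

section GeneratingFunctions

open PowerSeries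

/-! ### Generating functions of lattice cones -/

/-- The generating function, by weight, of the elements with a given property. -/
noncomputable def weightGF {α : Type*} (w : α → ℕ) (P : α → Prop) : PowerSeries ℚ :=
  PowerSeries.mk fun s => ({p | P p ∧ w p = s}.ncard : ℚ)

/-- Only finitely many elements have weight at most `s`. -/
def FiniteFibers {α : Type*} (w : α → ℕ) : Prop := ∀ s, {p | w p ≤ s}.Finite

theorem FiniteFibers.finite {α : Type*} {w : α → ℕ} (hw : FiniteFibers w) (P : α → Prop) (s : ℕ) :
    {p | P p ∧ w p = s}.Finite :=
  (hw s).subset fun _ hp => hp.2.le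

/-- Finite fibers are needed because `ncard` of an infinite set is `0`, which would break
additivity. -/
theorem weightGF_branch {α : Type*} {w : α → ℕ} (hw : FiniteFibers w) {P : α → Prop}
    (c : α → Prop) {F G : PowerSeries ℚ} (hF : weightGF w (fun p => P p ∧ c p) = F)
    (hG : weightGF w (fun p => P p ∧ ¬ c p) = G) : weightGF w P = F + G := by
  subst hF hG
  ext s
  simp only [weightGF, coeff_mk, map_add]
  rw [← Nat.cast_add, ← Set.ncard_union_eq _ (hw.finite _ _) (hw.finite _ _)]
  · congr 2
    ext p
    simp only [Set.mem_ofPred_eq, Set.mem_union]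
    tauto
  · rw [Set.disjoint_left]
    rintro p ⟨⟨-, h⟩, -⟩ ⟨⟨-, h'⟩, -⟩
    exact h' h

theorem weightGF_bij {α β : Type*} {w : α → ℕ} {v : β → ℕ} {P : α → Prop} {Q : β → Prop} (k : ℕ)
    (φ : β → α) (hP : ∀ b, Q b → P (φ b)) (hw : ∀ b, Q b → w (φ b) = k + v b)
    (hinj : ∀ b b', Q b → Q b' → φ b = φ b' → b = b') (hsurj : ∀ a, P a → ∃ b, Q b ∧ φ b = a) :
    weightGF w P = X ^ k * weightGF v Q := by
  ext s
  rw [coeff_X_pow_mul']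
  simp only [weightGF, coeff_mk]
  split_ifs with hk
  · rw [Nat.cast_inj]
    symm
    refine Set.ncard_congr (fun b _ => φ b) ?_ ?_ ?_
    · rintro b ⟨hb, hv⟩
      exact ⟨hP b hb, by rw [hw b hb]; omega⟩
    · rintro b b' ⟨hb, -⟩ ⟨hb', -⟩ h
      exact hinj b b' hb hb' h
    · rintro a ⟨ha, hs⟩
      obtain ⟨b, hb, rfl⟩ := hsurj a ha
      refine ⟨b, ⟨hb, ?_⟩, rfl⟩
      rw [hw b hb] at hs
      omega
  · rw [Nat.cast_eq_zero]
    convert Set.ncard_empty α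
    ext a
    simp only [Set.mem_ofPred_eq, Set.mem_empty_iff_false, iff_false, not_and]
    intro ha hs
    obtain ⟨b, hb, rfl⟩ := hsurj a ha
    rw [hw b hb] at hs
    omega

theorem FiniteFibers.mul_add {β : Type*} {v : β → ℕ} (hv : FiniteFibers v) {a : ℕ} (ha : 0 < a) :
    FiniteFibers fun p : ℕ × β => a * p.1 + v p.2 := fun s =>
  ((Set.finite_Iic s).prod (hv s)).subset fun p (hp : a * p.1 + v p.2 ≤ s) =>
    ⟨(Nat.le_mul_of_pos_left p.1 ha).trans ((Nat.le_add_right _ _).trans hp),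
      (Nat.le_add_left _ _).trans hp⟩

theorem one_sub_X_pow_mul_inv {a : ℕ} (ha : 0 < a) :
    (1 - X ^ a : PowerSeries ℚ) * (1 - X ^ a)⁻¹ = 1 :=
  PowerSeries.mul_inv_cancel _ (by simp [ha.ne'])

/-- A geometric series: the pairs with first coordinate `0` contribute the generating function of
`v`, and lowering a positive first coordinate by one identifies the others with the whole set, so `G
= F + X ^ a * G`. -/
theorem weightGF_mul_add {β : Type*} {v : β → ℕ} (hv : FiniteFibers v) {a : ℕ} (ha : 0 < a) :
    weightGF (fun p : ℕ × β => a * p.1 + v p.2) (fun _ => True) =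
      (1 - X ^ a)⁻¹ * weightGF v fun _ => True := by
  have h := weightGF_branch (hv.mul_add ha) (P := fun _ => True) (fun p => p.1 = 0)
    (weightGF_bij (v := v) (Q := fun _ => True) 0 (fun b => (0, b)) (by simp) (by simp) (by simp)
      (by simp))
    (weightGF_bij (v := fun p : ℕ × β => a * p.1 + v p.2) (Q := fun _ => True) a
      (fun p => (p.1 + 1, p.2)) (by simp) (by intros; simp only; ring) (by simp)
      (by
        rintro ⟨n, b⟩ ⟨-, hn⟩
        exact ⟨(n - 1, b), trivial, by simp only at hn ⊢; congr 1; omega⟩))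
  set G := weightGF (fun p : ℕ × β => a * p.1 + v p.2) fun _ => True
  linear_combination (1 - X ^ a)⁻¹ * h - G * one_sub_X_pow_mul_inv ha

theorem weightGF_unit : weightGF (fun _ : Unit => 0) (fun _ => True) = 1 := by
  ext s
  rw [weightGF, coeff_mk, coeff_one]
  split_ifs with hs
  · subst hs
    simp
  · rw [Nat.cast_eq_zero]
    convert Set.ncard_empty Unit
    ext
    simp [Ne.symm hs]

theorem finiteFibers_unit : FiniteFibers fun _ : Unit => 0 := fun _ => Set.toFinite _

/-- The generating function of a lattice cone with apex weight `k` and generators of the given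
weights. -/
noncomputable def coneGF (k : ℕ) (l : List ℕ) : PowerSeries ℚ :=
  X ^ k * (l.map fun a => (1 - X ^ a : PowerSeries ℚ)⁻¹).prod

theorem coneGF_mul (k : ℕ) (l : List ℕ) (hl : ∀ a ∈ l, 0 < a) :
    coneGF k l * (l.map fun a => (1 - X ^ a : PowerSeries ℚ)).prod = X ^ k := by
  rw [coneGF, mul_assoc, ← List.prod_map_mul,
    List.prod_eq_one (by
      simp only [List.mem_map, forall_exists_index, and_imp]
      rintro _ a ha rfl
      rw [mul_comm, one_sub_X_pow_mul_inv (hl a ha)]), mul_one]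

/-- `φ` parametrizes the lattice points of the cone by nonnegative coordinates along its generators,
and `ψ` recovers these coordinates. The two inverse identities say that the cone is unimodular, so
no further lattice points have to be added. -/
theorem weightGF_cone₂ {α : Type*} {w : α → ℕ} {P : α → Prop} (k a b : ℕ)
    (φ : ℕ × ℕ → α) (ψ : α → ℕ × ℕ)
    (hφ : ∀ x y, P (φ (x, y)) ∧ w (φ (x, y)) = k + (a * x + b * y) ∧ ψ (φ (x, y)) = (x, y))
    (hψ : ∀ p, P p → φ (ψ p) = p)
    (ha : 0 < a := by decide) (hb : 0 < b := by decide) :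
    weightGF w P = coneGF k [a, b] := by
  rw [weightGF_bij k (fun n : ℕ × ℕ × Unit => φ (n.1, n.2.1)) (Q := fun _ => True)
    (v := fun n => a * n.1 + (b * n.2.1 + 0)) (fun n _ => (hφ _ _).1) (fun n _ => (hφ _ _).2.1)
    ?_ fun p hp => ⟨((ψ p).1, (ψ p).2, ()), trivial, hψ p hp⟩,
    weightGF_mul_add (finiteFibers_unit.mul_add hb) ha, weightGF_mul_add finiteFibers_unit hb,
    weightGF_unit]
  · simp [coneGF]
  rintro ⟨x, y, _⟩ ⟨x', y', _⟩ - - h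
  have := congrArg ψ h
  simp only [(hφ _ _).2.2, Prod.mk.injEq] at this
  simp only [this]

theorem weightGF_cone₃ {α : Type*} {w : α → ℕ} {P : α → Prop} (k a b c : ℕ)
    (φ : ℕ × ℕ × ℕ → α) (ψ : α → ℕ × ℕ × ℕ)
    (hφ : ∀ x y z, P (φ (x, y, z)) ∧ w (φ (x, y, z)) = k + (a * x + (b * y + c * z)) ∧
      ψ (φ (x, y, z)) = (x, y, z))
    (hψ : ∀ p, P p → φ (ψ p) = p)
    (ha : 0 < a := by decide) (hb : 0 < b := by decide) (hc : 0 < c := by decide) :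
    weightGF w P = coneGF k [a, b, c] := by
  rw [weightGF_bij k (fun n : ℕ × ℕ × ℕ × Unit => φ (n.1, n.2.1, n.2.2.1)) (Q := fun _ => True)
    (v := fun n => a * n.1 + (b * n.2.1 + (c * n.2.2.1 + 0))) (fun n _ => (hφ _ _ _).1)
    (fun n _ => (hφ _ _ _).2.1)
    ?_ fun p hp => ⟨((ψ p).1, (ψ p).2.1, (ψ p).2.2, ()), trivial, hψ p hp⟩,
    weightGF_mul_add ((finiteFibers_unit.mul_add hc).mul_add hb) ha,
    weightGF_mul_add (finiteFibers_unit.mul_add hc) hb, weightGF_mul_add finiteFibers_unit hc,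
    weightGF_unit]
  · simp [coneGF]
  rintro ⟨x, y, z, _⟩ ⟨x', y', z', _⟩ - - h
  have := congrArg ψ h
  simp only [(hφ _ _ _).2.2, Prod.mk.injEq] at this
  simp only [this]

theorem weightGF_cone₄ {α : Type*} {w : α → ℕ} {P : α → Prop} (k a b c d : ℕ)
    (φ : ℕ × ℕ × ℕ × ℕ → α) (ψ : α → ℕ × ℕ × ℕ × ℕ)
    (hφ : ∀ x y z u, P (φ (x, y, z, u)) ∧
      w (φ (x, y, z, u)) = k + (a * x + (b * y + (c * z + d * u))) ∧
      ψ (φ (x, y, z, u)) = (x, y, z, u))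
    (hψ : ∀ p, P p → φ (ψ p) = p)
    (ha : 0 < a := by decide) (hb : 0 < b := by decide) (hc : 0 < c := by decide) (hd : 0 < d := by decide) :
    weightGF w P = coneGF k [a, b, c, d] := by
  rw [weightGF_bij k (fun n : ℕ × ℕ × ℕ × ℕ × Unit => φ (n.1, n.2.1, n.2.2.1, n.2.2.2.1))
    (Q := fun _ => True)
    (v := fun n => a * n.1 + (b * n.2.1 + (c * n.2.2.1 + (d * n.2.2.2.1 + 0))))
    (fun n _ => (hφ _ _ _ _).1) (fun n _ => (hφ _ _ _ _).2.1)
    ?_ fun p hp => ⟨((ψ p).1, (ψ p).2.1, (ψ p).2.2.1, (ψ p).2.2.2, ()), trivial, hψ p hp⟩,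
    weightGF_mul_add (((finiteFibers_unit.mul_add hd).mul_add hc).mul_add hb) ha,
    weightGF_mul_add ((finiteFibers_unit.mul_add hd).mul_add hc) hb,
    weightGF_mul_add (finiteFibers_unit.mul_add hd) hc, weightGF_mul_add finiteFibers_unit hd,
    weightGF_unit]
  · simp [coneGF]
  rintro ⟨x, y, z, u, _⟩ ⟨x', y', z', u', _⟩ - - h
  have := congrArg ψ h
  simp only [(hφ _ _ _ _).2.2, Prod.mk.injEq] at this
  simp only [this]

/-! ### Decomposition of the parameter space into cones -/

/-- The parameters `(d, g, f, e)` of the line-distinct squares in normal form. -/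
def Admissible : ℕ × ℕ × ℕ × ℕ → Prop := fun (d, g, f, e) =>
  1 ≤ e ∧ f ≠ d ∧ d ≠ g ∧ d ≠ f + g ∧ g ≠ e ∧ g ≠ e + f ∧ g ≠ e + d ∧ g ≠ e + f + d

/-- The magic sum of the square with parameters `(d, g, f, e)`. -/
def weight : ℕ × ℕ × ℕ × ℕ → ℕ := fun (d, g, f, e) => 2 * d + 2 * g + 2 * f + e

theorem finiteFibers_weight : FiniteFibers weight := fun s =>
  ((Set.finite_Iic s).prod ((Set.finite_Iic s).prod ((Set.finite_Iic s).prod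
    (Set.finite_Iic s)))).subset fun ⟨d, g, f, e⟩ hp => by
    simp only [weight, Set.mem_ofPred_eq] at hp
    simp only [Set.mem_prod, Set.mem_Iic]
    omega

theorem weightGF_admissible :
    weightGF weight Admissible =
      ((coneGF 9 [7, 5, 3, 1] + (coneGF 21 [5, 3, 7, 6] + (coneGF 12 [6, 3, 5, 4] + ((coneGF 21
      [9, 8, 4, 6] + coneGF 24 [4, 3, 9, 8]) + coneGF 9 [8, 4, 3, 2])))) + ((coneGF 17 [5, 7, 4,
      1] + ((coneGF 15 [9, 6, 8, 4] + coneGF 22 [9, 7, 6, 4]) + ((coneGF 20 [9, 8, 5, 6] + coneGF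
      27 [9, 7, 6, 5]) + coneGF 23 [8, 5, 4, 6]))) + (coneGF 3 [4, 5, 2, 1] + ((coneGF 19 [2, 9,
      8, 4] + coneGF 24 [2, 5, 9, 8]) + coneGF 11 [8, 2, 5, 4])))) + ((coneGF 6 [7, 2, 3, 1] +
      (coneGF 18 [2, 3, 7, 6] + ((coneGF 9 [6, 5, 4, 2] + coneGF 12 [6, 3, 5, 4]) + ((coneGF 21
      [4, 9, 8, 6] + coneGF 24 [4, 3, 9, 8]) + coneGF 9 [8, 4, 3, 2])))) + (coneGF 7 [7, 4, 2, 1]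
      + coneGF 19 [7, 6, 4, 2])) := by
  have hw := finiteFibers_weight
  -- Branching on a strict inequality follows a wall of the arrangement; equality is excluded by
  -- admissibility, so both sides are open. The conditions with `≤` are auxiliary cuts that make the
  -- remaining chambers unimodular; their points of equality go to the `≤` side, so there the
  -- matching coordinate of `ψ` is a difference without the usual `+ 1`.
  refine weightGF_branch hw (fun (d, _, f, _) => f < d)
     (weightGF_branch hw (fun (d, g, _, _) => d < g)
      (weightGF_branch hw (fun (_, g, _, e) => g < e)
       (weightGF_cone₄ 9 7 5 3 1
         (fun (x, y, z, u) => (x + y + 1, x + y + z + 2, x, x + y + z + u + 3))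
         (fun (d, g, f, e) => (f, d - (f + 1), g - (d + 1), e - (g + 1))) ?_ ?_)
       (weightGF_branch hw (fun (_, g, f, e) => g < e + f)
        (weightGF_cone₄ 21 5 3 7 6
          (fun (x, y, z, u) => (x + z + u + 3, x + y + z + u + 4, z + u + 2, x + y + z + 3))
          (fun (d, g, f, e) => (d - (f + 1), g - (d + 1), (f + e) - (g + 1), g - (e + 1))) ?_ ?_)
        (weightGF_branch hw (fun (d, g, _, e) => g < e + d)
         (weightGF_cone₄ 12 6 3 5 4
           (fun (x, y, z, u) => (x + z + u + 2, x + y + z + u + 3, x, y + z + 2))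
           (fun (d, g, f, e) => (f, g - (d + 1), (d + e) - (g + 1), g - (f + e + 1))) ?_ ?_)
         (weightGF_branch hw (fun (d, g, f, e) => g < e + f + d)
          (weightGF_branch hw (fun (d, g, f, _) => g ≤ d + f)
           (weightGF_cone₄ 21 9 8 4 6
             (fun (x, y, z, u) => (x + y + z + u + 3, 2 * x + 2 * y + z + u + 5, x + y + u + 2, x + 1))
             (fun (d, g, f, e) => (e - 1, g - (d + e + 1), d - (f + 1), (d + f) - g)) ?_ ?_)
           (weightGF_cone₄ 24 4 3 9 8
             (fun (x, y, z, u) => (x + z + u + 3, x + y + 2 * z + 2 * u + 6, z + u + 2, y + z + 2))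
             (fun (d, g, f, e) => (d - (f + 1), g - (d + f + 1), (d + f + e) - (g + 1), g - (d + e + 1))) ?_ ?_))
          (weightGF_cone₄ 9 8 4 3 2
            (fun (x, y, z, u) => (x + y + 1, 2 * x + y + z + u + 3, x, z + 1))
            (fun (d, g, f, e) => (f, d - (f + 1), e - 1, g - (d + f + e + 1))) ?_ ?_)))))
      (weightGF_branch hw (fun (d, g, f, _) => d < f + g)
       (weightGF_branch hw (fun (_, g, _, e) => g < e)
        (weightGF_cone₄ 17 5 7 4 1
          (fun (x, y, z, u) => (x + y + z + 3, x + y + 2, y + z + 2, x + y + u + 3))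
          (fun (d, g, f, e) => (d - (f + 1), (g + f) - (d + 1), d - (g + 1), e - (g + 1))) ?_ ?_)
        (weightGF_branch hw (fun (_, g, f, _) => g ≤ f)
         (weightGF_branch hw (fun (d, _, f, e) => e + f ≤ d)
          (weightGF_cone₄ 15 9 6 8 4
            (fun (x, y, z, u) => (2 * x + y + 2 * z + u + 3, x + y + z + 2, x + y + z + u + 2, x + 1))
            (fun (d, g, f, e) => (e - 1, (g + f) - (d + 1), d - (f + e), f - g)) ?_ ?_)
          (weightGF_cone₄ 22 9 7 6 4
            (fun (x, y, z, u) => (2 * x + y + z + u + 4, x + y + z + 3, x + y + z + u + 3, x + y + 2))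
            (fun (d, g, f, e) => (d - (f + 1), (f + e) - (d + 1), g - (e + 1), f - g)) ?_ ?_))
         (weightGF_branch hw (fun (_, g, f, e) => g < e + f)
          (weightGF_branch hw (fun (d, _, f, e) => e + f ≤ d)
           (weightGF_cone₄ 20 9 8 5 6
             (fun (x, y, z, u) => (2 * x + 2 * y + z + u + 4, x + y + z + u + 3, x + y + u + 2, x + z + 2))
             (fun (d, g, f, e) => ((f + e) - (g + 1), d - (f + e), g - (f + 1), (g + f) - (d + 1))) ?_ ?_)
           (weightGF_cone₄ 27 9 7 6 5
             (fun (x, y, z, u) => (2 * x + y + z + u + 5, x + y + z + u + 4, x + y + z + 3, x + y + u + 3))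
             (fun (d, g, f, e) => (d - (g + 1), (f + e) - (d + 1), g - (e + 1), g - (f + 1))) ?_ ?_))
          (weightGF_cone₄ 23 8 5 4 6
            (fun (x, y, z, u) => (2 * x + y + z + u + 5, x + y + z + u + 4, x + u + 2, y + 1))
            (fun (d, g, f, e) => (d - (g + 1), e - 1, g - (f + e + 1), (g + f) - (d + 1))) ?_ ?_))))
       (weightGF_branch hw (fun (_, g, _, e) => g < e)
        (weightGF_cone₄ 3 4 5 2 1
          (fun (x, y, z, u) => (x + y + z + 1, y, x, y + u + 1))
          (fun (d, g, f, e) => (f, g, d - (g + f + 1), e - (g + 1))) ?_ ?_)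
        (weightGF_branch hw (fun (_, g, f, e) => g < e + f)
         (weightGF_branch hw (fun (_, g, f, _) => g ≤ f)
          (weightGF_cone₄ 19 2 9 8 4
            (fun (x, y, z, u) => (x + 2 * y + 2 * z + u + 5, y + z + 2, y + z + u + 2, y + 1))
            (fun (d, g, f, e) => (d - (g + f + 1), e - 1, g - (e + 1), f - g)) ?_ ?_)
          (weightGF_cone₄ 24 2 5 9 8
            (fun (x, y, z, u) => (x + y + 2 * z + 2 * u + 6, y + z + u + 3, z + u + 2, y + z + 2))
            (fun (d, g, f, e) => (d - (g + f + 1), g - (f + 1), (f + e) - (g + 1), g - (e + 1))) ?_ ?_))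
         (weightGF_cone₄ 11 8 2 5 4
           (fun (x, y, z, u) => (2 * x + y + z + u + 3, x + z + u + 2, x, z + 1))
           (fun (d, g, f, e) => (f, d - (g + f + 1), e - 1, g - (f + e + 1))) ?_ ?_)))))
     (weightGF_branch hw (fun (d, g, _, _) => d < g)
      (weightGF_branch hw (fun (_, g, _, e) => g < e)
       (weightGF_cone₄ 6 7 2 3 1
         (fun (x, y, z, u) => (x, x + z + 1, x + y + 1, x + z + u + 2))
         (fun (d, g, f, e) => (d, f - (d + 1), g - (d + 1), e - (g + 1))) ?_ ?_)
       (weightGF_branch hw (fun (d, g, _, e) => g < e + d)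
        (weightGF_cone₄ 18 2 3 7 6
          (fun (x, y, z, u) => (z + u + 2, y + z + u + 3, x + z + u + 3, y + z + 2))
          (fun (d, g, f, e) => (f - (d + 1), g - (d + 1), (d + e) - (g + 1), g - (e + 1))) ?_ ?_)
        (weightGF_branch hw (fun (_, g, f, e) => g < e + f)
         (weightGF_branch hw (fun (_, g, f, _) => g ≤ f)
          (weightGF_cone₄ 9 6 5 4 2
            (fun (x, y, z, u) => (x, x + y + z + 2, x + y + z + u + 2, y + 1))
            (fun (d, g, f, e) => (d, e - 1, g - (d + e + 1), f - g)) ?_ ?_)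
          (weightGF_cone₄ 12 6 3 5 4
            (fun (x, y, z, u) => (x, x + y + z + u + 3, x + z + u + 2, y + z + 2))
            (fun (d, g, f, e) => (d, g - (f + 1), (f + e) - (g + 1), g - (d + e + 1))) ?_ ?_))
         (weightGF_branch hw (fun (d, g, f, e) => g < e + f + d)
          (weightGF_branch hw (fun (d, g, f, _) => g ≤ f + d)
           (weightGF_cone₄ 21 4 9 8 6
             (fun (x, y, z, u) => (y + z + u + 2, x + 2 * y + 2 * z + u + 5, x + y + z + u + 3, y + 1))
             (fun (d, g, f, e) => (f - (d + 1), e - 1, g - (f + e + 1), (d + f) - g)) ?_ ?_)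
           (weightGF_cone₄ 24 4 3 9 8
             (fun (x, y, z, u) => (z + u + 2, x + y + 2 * z + 2 * u + 6, x + z + u + 3, y + z + 2))
             (fun (d, g, f, e) => (f - (d + 1), g - (d + f + 1), (d + f + e) - (g + 1), g - (f + e + 1))) ?_ ?_))
          (weightGF_cone₄ 9 8 4 3 2
            (fun (x, y, z, u) => (x, 2 * x + y + z + u + 3, x + y + 1, z + 1))
            (fun (d, g, f, e) => (d, f - (d + 1), e - 1, g - (d + f + e + 1))) ?_ ?_)))))
      (weightGF_branch hw (fun (_, g, _, e) => g < e)
       (weightGF_cone₄ 7 7 4 2 1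
         (fun (x, y, z, u) => (x + y + 1, x, x + y + z + 2, x + u + 1))
         (fun (d, g, f, e) => (g, d - (g + 1), f - (d + 1), e - (g + 1))) ?_ ?_)
       (weightGF_cone₄ 19 7 6 4 2
         (fun (x, y, z, u) => (x + y + z + 3, x + y + 2, x + y + z + u + 4, x + 1))
         (fun (d, g, f, e) => (e - 1, g - (e + 1), d - (g + 1), f - (d + 1))) ?_ ?_)))
  all_goals first
    | (intros; dsimp only [weight, Admissible]; simp only [Prod.mk.injEq, true_and, and_true]; omega)
    | (rintro ⟨d, g, f, e⟩ h; dsimp only [Admissible] at h ⊢; simp only [Prod.mk.injEq, true_and, and_true]; omega)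

theorem weightGF_zero_f :
    weightGF weight (fun p => Admissible p ∧ p.2.2.1 = 0 ∧ 0 < p.2.1) =
      (coneGF 9 [5, 3, 1] + (coneGF 12 [3, 5, 4] + coneGF 9 [4, 3, 2])) + (coneGF 8 [5, 2, 1] +
      coneGF 11 [5, 4, 2]) := by
  have hw := finiteFibers_weight
  refine weightGF_branch hw (fun (d, g, _, _) => d < g)
     (weightGF_branch hw (fun (_, g, _, e) => g < e)
      (weightGF_cone₃ 9 5 3 1
        (fun (x, y, z) => (x + 1, x + y + 2, 0, x + y + z + 3))
        (fun (d, g, f, e) => (d - 1, g - (d + 1), e - (g + 1))) ?_ ?_)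
      (weightGF_branch hw (fun (d, g, _, e) => g < e + d)
       (weightGF_cone₃ 12 3 5 4
         (fun (x, y, z) => (y + z + 2, x + y + z + 3, 0, x + y + 2))
         (fun (d, g, f, e) => (g - (d + 1), (d + e) - (g + 1), g - (e + 1))) ?_ ?_)
       (weightGF_cone₃ 9 4 3 2
         (fun (x, y, z) => (x + 1, x + y + z + 3, 0, y + 1))
         (fun (d, g, f, e) => (d - 1, e - 1, g - (d + e + 1))) ?_ ?_)))
     (weightGF_branch hw (fun (_, g, _, e) => g < e)
      (weightGF_cone₃ 8 5 2 1
        (fun (x, y, z) => (x + y + 2, x + 1, 0, x + z + 2))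
        (fun (d, g, f, e) => (g - 1, d - (g + 1), e - (g + 1))) ?_ ?_)
      (weightGF_cone₃ 11 5 4 2
        (fun (x, y, z) => (x + y + z + 3, x + y + 2, 0, x + 1))
        (fun (d, g, f, e) => (e - 1, g - (e + 1), d - (g + 1))) ?_ ?_))
  all_goals first
    | (intros; dsimp only [weight, Admissible]; simp only [Prod.mk.injEq, true_and, and_true]; omega)
    | (rintro ⟨d, g, f, e⟩ h; dsimp only [Admissible] at h ⊢; simp only [Prod.mk.injEq, true_and, and_true]; omega)

theorem weightGF_zero_d :
    weightGF weight (fun p => Admissible p ∧ p.1 = 0 ∧ 0 < p.2.1 ∧ 0 < p.2.2.1) =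
      coneGF 6 [2, 3, 1] + ((coneGF 9 [5, 4, 2] + coneGF 12 [3, 5, 4]) + coneGF 9 [4, 3, 2]) := by
  have hw := finiteFibers_weight
  refine weightGF_branch hw (fun (_, g, _, e) => g < e)
     (weightGF_cone₃ 6 2 3 1
       (fun (x, y, z) => (0, y + 1, x + 1, y + z + 2))
       (fun (d, g, f, e) => (f - 1, g - 1, e - (g + 1))) ?_ ?_)
     (weightGF_branch hw (fun (_, g, f, e) => g < e + f)
      (weightGF_branch hw (fun (_, g, f, _) => g ≤ f)
       (weightGF_cone₃ 9 5 4 2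
         (fun (x, y, z) => (0, x + y + 2, x + y + z + 2, x + 1))
         (fun (d, g, f, e) => (e - 1, g - (e + 1), f - g)) ?_ ?_)
       (weightGF_cone₃ 12 3 5 4
         (fun (x, y, z) => (0, x + y + z + 3, y + z + 2, x + y + 2))
         (fun (d, g, f, e) => (g - (f + 1), (f + e) - (g + 1), g - (e + 1))) ?_ ?_))
      (weightGF_cone₃ 9 4 3 2
        (fun (x, y, z) => (0, x + y + z + 3, x + 1, y + 1))
        (fun (d, g, f, e) => (f - 1, e - 1, g - (f + e + 1))) ?_ ?_))
  all_goals first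
    | (intros; dsimp only [weight, Admissible]; simp only [Prod.mk.injEq, true_and, and_true]; omega)
    | (rintro ⟨d, g, f, e⟩ h; dsimp only [Admissible] at h ⊢; simp only [Prod.mk.injEq, true_and, and_true]; omega)

theorem weightGF_zero_g :
    weightGF weight (fun p => Admissible p ∧ p.2.1 = 0 ∧ 0 < p.2.2.1 ∧ 0 < p.1) =
      coneGF 7 [4, 2, 1] + coneGF 7 [4, 2, 1] := by
  have hw := finiteFibers_weight
  refine weightGF_branch hw (fun (d, _, f, _) => f < d)
     (weightGF_cone₃ 7 4 2 1
       (fun (x, y, z) => (x + y + 2, 0, x + 1, z + 1))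
       (fun (d, g, f, e) => (f - 1, d - (f + 1), e - 1)) ?_ ?_)
     (weightGF_cone₃ 7 4 2 1
       (fun (x, y, z) => (x + 1, 0, x + y + 2, z + 1))
       (fun (d, g, f, e) => (d - 1, f - (d + 1), e - 1)) ?_ ?_)
  all_goals first
    | (intros; dsimp only [weight, Admissible]; simp only [Prod.mk.injEq, true_and, and_true]; omega)
    | (rintro ⟨d, g, f, e⟩ h; dsimp only [Admissible] at h ⊢; simp only [Prod.mk.injEq, true_and, and_true]; omega)

theorem weightGF_zero_f_g :
    weightGF weight (fun p => Admissible p ∧ p.2.2.1 = 0 ∧ p.2.1 = 0) =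
      coneGF 3 [2, 1] := by
  have hw := finiteFibers_weight
  refine weightGF_cone₂ 3 2 1
      (fun (x, y) => (x + 1, 0, 0, y + 1))
      (fun (d, g, f, e) => (d - 1, e - 1)) ?_ ?_
  all_goals first
    | (intros; dsimp only [weight, Admissible]; simp only [Prod.mk.injEq, true_and, and_true]; omega)
    | (rintro ⟨d, g, f, e⟩ h; dsimp only [Admissible] at h ⊢; simp only [Prod.mk.injEq, true_and, and_true]; omega)

/-! ### Summation over a common denominator -/

/-- A common denominator of the generating functions of the cones. -/
noncomputable def commonDen : PowerSeries ℚ :=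
  (1 - X ^ 5) * (1 - X ^ 7) * (1 - X ^ 8) * (1 - X ^ 9) * (1 + X) ^ 2 * (1 + X + X ^ 2) *
    (1 + X ^ 2) * (1 - X + X ^ 2)

theorem commonDen_ne_zero : commonDen ≠ 0 := fun h => by
  simpa [commonDen] using congrArg (constantCoeff (R := ℚ)) h

theorem mul_coneGF (k : ℕ) (l : List ℕ) {D Q : PowerSeries ℚ} (hl : ∀ a ∈ l, 0 < a)
    (h : (l.map fun a => (1 - X ^ a : PowerSeries ℚ)).prod * Q = D) :
    D * coneGF k l = X ^ k * Q := by
  rw [← h, ← coneGF_mul k l hl]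
  ring

set_option maxHeartbeats 2000000 in
theorem commonDen_mul_weightGF_admissible :
    commonDen * weightGF weight Admissible =
      X ^ 3 + 3 * X ^ 4 + 7 * X ^ 5 + 14 * X ^ 6 + 26 * X ^ 7 + 44 * X ^ 8 + 74 * X ^ 9 + 112 *
      X ^ 10 + 162 * X ^ 11 + 222 * X ^ 12 + 289 * X ^ 13 + 354 * X ^ 14 + 421 * X ^ 15 + 474 *
      X ^ 16 + 513 * X ^ 17 + 532 * X ^ 18 + 533 * X ^ 19 + 510 * X ^ 20 + 479 * X ^ 21 + 432 *
      X ^ 22 + 383 * X ^ 23 + 334 * X ^ 24 + 290 * X ^ 25 + 246 * X ^ 26 + 217 * X ^ 27 + 188 *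
      X ^ 28 + 164 * X ^ 29 + 140 * X ^ 30 + 118 * X ^ 31 + 92 * X ^ 32 + 73 * X ^ 33 + 52 * X ^
      34 + 33 * X ^ 35 + 19 * X ^ 36 + 9 * X ^ 37 := by
  rw [weightGF_admissible]
  simp only [mul_add]
  -- Each `Q` is the cofactor of the cone's denominator in `commonDen`, written as a product of
  -- cyclotomic factors. Cones with equal data share one rewrite.
  rw [mul_coneGF 9 [7, 5, 3, 1] (Q := (1 + X) ^ 3 * (1 + X + X ^ 2) * (1 + X ^ 2) ^ 2 * (1 - X + X ^ 2) * (1 + X ^ 4) * (1 + X ^ 3 + X ^ 6))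
      (by decide) (by simp only [commonDen, List.map, List.prod_cons, List.prod_nil]; ring),
    mul_coneGF 21 [5, 3, 7, 6] (Q := (1 + X) ^ 2 * (1 + X ^ 2) ^ 2 * (1 + X ^ 4) * (1 + X ^ 3 + X ^ 6))
      (by decide) (by simp only [commonDen, List.map, List.prod_cons, List.prod_nil]; ring),
    mul_coneGF 12 [6, 3, 5, 4] (Q := (1 + X) * (1 + X ^ 2) * (1 + X + X ^ 2 + X ^ 3 + X ^ 4 + X ^ 5 + X ^ 6) * (1 + X ^ 4) * (1 + X ^ 3 + X ^ 6))
      (by decide) (by simp only [commonDen, List.map, List.prod_cons, List.prod_nil]; ring),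
    mul_coneGF 21 [9, 8, 4, 6] (Q := (1 + X + X ^ 2 + X ^ 3 + X ^ 4) * (1 + X + X ^ 2 + X ^ 3 + X ^ 4 + X ^ 5 + X ^ 6))
      (by decide) (by simp only [commonDen, List.map, List.prod_cons, List.prod_nil]; ring),
    mul_coneGF 24 [4, 3, 9, 8] (Q := (1 + X) * (1 + X + X ^ 2 + X ^ 3 + X ^ 4) * (1 - X + X ^ 2) * (1 + X + X ^ 2 + X ^ 3 + X ^ 4 + X ^ 5 + X ^ 6))
      (by decide) (by simp only [commonDen, List.map, List.prod_cons, List.prod_nil]; ring),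
    mul_coneGF 9 [8, 4, 3, 2] (Q := (1 + X + X ^ 2) * (1 + X + X ^ 2 + X ^ 3 + X ^ 4) * (1 - X + X ^ 2) * (1 + X + X ^ 2 + X ^ 3 + X ^ 4 + X ^ 5 + X ^ 6) * (1 + X ^ 3 + X ^ 6))
      (by decide) (by simp only [commonDen, List.map, List.prod_cons, List.prod_nil]; ring),
    mul_coneGF 17 [5, 7, 4, 1] (Q := (1 + X) ^ 2 * (1 + X + X ^ 2) ^ 2 * (1 + X ^ 2) * (1 - X + X ^ 2) * (1 + X ^ 4) * (1 + X ^ 3 + X ^ 6))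
      (by decide) (by simp only [commonDen, List.map, List.prod_cons, List.prod_nil]; ring),
    mul_coneGF 15 [9, 6, 8, 4] (Q := (1 + X + X ^ 2 + X ^ 3 + X ^ 4) * (1 + X + X ^ 2 + X ^ 3 + X ^ 4 + X ^ 5 + X ^ 6))
      (by decide) (by simp only [commonDen, List.map, List.prod_cons, List.prod_nil]; ring),
    mul_coneGF 22 [9, 7, 6, 4] (Q := (1 + X) * (1 + X ^ 2) * (1 + X + X ^ 2 + X ^ 3 + X ^ 4) * (1 + X ^ 4))
      (by decide) (by simp only [commonDen, List.map, List.prod_cons, List.prod_nil]; ring),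
    mul_coneGF 20 [9, 8, 5, 6] (Q := (1 + X) * (1 + X ^ 2) * (1 + X + X ^ 2 + X ^ 3 + X ^ 4 + X ^ 5 + X ^ 6))
      (by decide) (by simp only [commonDen, List.map, List.prod_cons, List.prod_nil]; ring),
    mul_coneGF 27 [9, 7, 6, 5] (Q := (1 + X) ^ 2 * (1 + X ^ 2) ^ 2 * (1 + X ^ 4))
      (by decide) (by simp only [commonDen, List.map, List.prod_cons, List.prod_nil]; ring),
    mul_coneGF 23 [8, 5, 4, 6] (Q := (1 + X + X ^ 2) * (1 + X + X ^ 2 + X ^ 3 + X ^ 4 + X ^ 5 + X ^ 6) * (1 + X ^ 3 + X ^ 6))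
      (by decide) (by simp only [commonDen, List.map, List.prod_cons, List.prod_nil]; ring),
    mul_coneGF 3 [4, 5, 2, 1] (Q := (1 + X) * (1 + X + X ^ 2) ^ 2 * (1 + X ^ 2) * (1 - X + X ^ 2) * (1 + X + X ^ 2 + X ^ 3 + X ^ 4 + X ^ 5 + X ^ 6) * (1 + X ^ 4) * (1 + X ^ 3 + X ^ 6))
      (by decide) (by simp only [commonDen, List.map, List.prod_cons, List.prod_nil]; ring),
    mul_coneGF 19 [2, 9, 8, 4] (Q := (1 + X + X ^ 2) * (1 + X + X ^ 2 + X ^ 3 + X ^ 4) * (1 - X + X ^ 2) * (1 + X + X ^ 2 + X ^ 3 + X ^ 4 + X ^ 5 + X ^ 6))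
      (by decide) (by simp only [commonDen, List.map, List.prod_cons, List.prod_nil]; ring),
    mul_coneGF 24 [2, 5, 9, 8] (Q := (1 + X) * (1 + X + X ^ 2) * (1 + X ^ 2) * (1 - X + X ^ 2) * (1 + X + X ^ 2 + X ^ 3 + X ^ 4 + X ^ 5 + X ^ 6))
      (by decide) (by simp only [commonDen, List.map, List.prod_cons, List.prod_nil]; ring),
    mul_coneGF 11 [8, 2, 5, 4] (Q := (1 + X + X ^ 2) ^ 2 * (1 - X + X ^ 2) * (1 + X + X ^ 2 + X ^ 3 + X ^ 4 + X ^ 5 + X ^ 6) * (1 + X ^ 3 + X ^ 6))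
      (by decide) (by simp only [commonDen, List.map, List.prod_cons, List.prod_nil]; ring),
    mul_coneGF 6 [7, 2, 3, 1] (Q := (1 + X) ^ 2 * (1 + X + X ^ 2) * (1 + X ^ 2) ^ 2 * (1 + X + X ^ 2 + X ^ 3 + X ^ 4) * (1 - X + X ^ 2) * (1 + X ^ 4) * (1 + X ^ 3 + X ^ 6))
      (by decide) (by simp only [commonDen, List.map, List.prod_cons, List.prod_nil]; ring),
    mul_coneGF 18 [2, 3, 7, 6] (Q := (1 + X) * (1 + X ^ 2) ^ 2 * (1 + X + X ^ 2 + X ^ 3 + X ^ 4) * (1 + X ^ 4) * (1 + X ^ 3 + X ^ 6))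
      (by decide) (by simp only [commonDen, List.map, List.prod_cons, List.prod_nil]; ring),
    mul_coneGF 9 [6, 5, 4, 2] (Q := (1 + X + X ^ 2) * (1 + X ^ 2) * (1 + X + X ^ 2 + X ^ 3 + X ^ 4 + X ^ 5 + X ^ 6) * (1 + X ^ 4) * (1 + X ^ 3 + X ^ 6))
      (by decide) (by simp only [commonDen, List.map, List.prod_cons, List.prod_nil]; ring),
    mul_coneGF 21 [4, 9, 8, 6] (Q := (1 + X + X ^ 2 + X ^ 3 + X ^ 4) * (1 + X + X ^ 2 + X ^ 3 + X ^ 4 + X ^ 5 + X ^ 6))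
      (by decide) (by simp only [commonDen, List.map, List.prod_cons, List.prod_nil]; ring),
    mul_coneGF 7 [7, 4, 2, 1] (Q := (1 + X) * (1 + X + X ^ 2) ^ 2 * (1 + X ^ 2) * (1 + X + X ^ 2 + X ^ 3 + X ^ 4) * (1 - X + X ^ 2) * (1 + X ^ 4) * (1 + X ^ 3 + X ^ 6))
      (by decide) (by simp only [commonDen, List.map, List.prod_cons, List.prod_nil]; ring),
    mul_coneGF 19 [7, 6, 4, 2] (Q := (1 + X + X ^ 2) * (1 + X ^ 2) * (1 + X + X ^ 2 + X ^ 3 + X ^ 4) * (1 + X ^ 4) * (1 + X ^ 3 + X ^ 6))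
      (by decide) (by simp only [commonDen, List.map, List.prod_cons, List.prod_nil]; ring)]
  ring

set_option maxHeartbeats 2000000 in
theorem commonDen_mul_weightGF_zero_f :
    commonDen * weightGF weight (fun p => Admissible p ∧ p.2.2.1 = 0 ∧ 0 < p.2.1) =
      X ^ 8 + 5 * X ^ 9 + 12 * X ^ 10 + 24 * X ^ 11 + 42 * X ^ 12 + 65 * X ^ 13 + 90 * X ^ 14 +
      119 * X ^ 15 + 144 * X ^ 16 + 162 * X ^ 17 + 169 * X ^ 18 + 162 * X ^ 19 + 139 * X ^ 20 +
      103 * X ^ 21 + 55 * X ^ 22 + X ^ 23 - 54 * X ^ 24 - 102 * X ^ 25 - 139 * X ^ 26 - 162 * X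
      ^ 27 - 169 * X ^ 28 - 163 * X ^ 29 - 145 * X ^ 30 - 120 * X ^ 31 - 91 * X ^ 32 - 65 * X ^
      33 - 42 * X ^ 34 - 24 * X ^ 35 - 12 * X ^ 36 - 5 * X ^ 37 := by
  rw [weightGF_zero_f]
  simp only [mul_add]
  rw [mul_coneGF 9 [5, 3, 1] (Q := (1 - X) * (1 + X) ^ 3 * (1 + X + X ^ 2) * (1 + X ^ 2) ^ 2 * (1 - X + X ^ 2) * (1 + X + X ^ 2 + X ^ 3 + X ^ 4 + X ^ 5 + X ^ 6) * (1 + X ^ 4) * (1 + X ^ 3 + X ^ 6))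
      (by decide) (by simp only [commonDen, List.map, List.prod_cons, List.prod_nil]; ring),
    mul_coneGF 12 [3, 5, 4] (Q := (1 - X) * (1 + X) ^ 2 * (1 + X + X ^ 2) * (1 + X ^ 2) * (1 - X + X ^ 2) * (1 + X + X ^ 2 + X ^ 3 + X ^ 4 + X ^ 5 + X ^ 6) * (1 + X ^ 4) * (1 + X ^ 3 + X ^ 6))
      (by decide) (by simp only [commonDen, List.map, List.prod_cons, List.prod_nil]; ring),
    mul_coneGF 9 [4, 3, 2] (Q := (1 - X) * (1 + X) * (1 + X + X ^ 2) * (1 + X ^ 2) * (1 + X + X ^ 2 + X ^ 3 + X ^ 4) * (1 - X + X ^ 2) * (1 + X + X ^ 2 + X ^ 3 + X ^ 4 + X ^ 5 + X ^ 6) * (1 + X ^ 4) * (1 + X ^ 3 + X ^ 6))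
      (by decide) (by simp only [commonDen, List.map, List.prod_cons, List.prod_nil]; ring),
    mul_coneGF 8 [5, 2, 1] (Q := (1 - X) * (1 + X) ^ 2 * (1 + X + X ^ 2) ^ 2 * (1 + X ^ 2) ^ 2 * (1 - X + X ^ 2) * (1 + X + X ^ 2 + X ^ 3 + X ^ 4 + X ^ 5 + X ^ 6) * (1 + X ^ 4) * (1 + X ^ 3 + X ^ 6))
      (by decide) (by simp only [commonDen, List.map, List.prod_cons, List.prod_nil]; ring),
    mul_coneGF 11 [5, 4, 2] (Q := (1 - X) * (1 + X) * (1 + X + X ^ 2) ^ 2 * (1 + X ^ 2) * (1 - X + X ^ 2) * (1 + X + X ^ 2 + X ^ 3 + X ^ 4 + X ^ 5 + X ^ 6) * (1 + X ^ 4) * (1 + X ^ 3 + X ^ 6))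
      (by decide) (by simp only [commonDen, List.map, List.prod_cons, List.prod_nil]; ring)]
  ring

set_option maxHeartbeats 2000000 in
theorem commonDen_mul_weightGF_zero_d :
    commonDen * weightGF weight (fun p => Admissible p ∧ p.1 = 0 ∧ 0 < p.2.1 ∧ 0 < p.2.2.1) =
      X ^ 6 + 3 * X ^ 7 + 7 * X ^ 8 + 16 * X ^ 9 + 28 * X ^ 10 + 45 * X ^ 11 + 67 * X ^ 12 + 92
      * X ^ 13 + 116 * X ^ 14 + 139 * X ^ 15 + 154 * X ^ 16 + 159 * X ^ 17 + 151 * X ^ 18 + 130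
      * X ^ 19 + 95 * X ^ 20 + 51 * X ^ 21 + X ^ 22 - 49 * X ^ 23 - 94 * X ^ 24 - 129 * X ^ 25 -
      151 * X ^ 26 - 160 * X ^ 27 - 155 * X ^ 28 - 140 * X ^ 29 - 118 * X ^ 30 - 93 * X ^ 31 -
      67 * X ^ 32 - 46 * X ^ 33 - 28 * X ^ 34 - 15 * X ^ 35 - 7 * X ^ 36 - 3 * X ^ 37 := by
  rw [weightGF_zero_d]
  simp only [mul_add]
  rw [mul_coneGF 6 [2, 3, 1] (Q := (1 - X) * (1 + X) ^ 2 * (1 + X + X ^ 2) * (1 + X ^ 2) ^ 2 * (1 + X + X ^ 2 + X ^ 3 + X ^ 4) * (1 - X + X ^ 2) * (1 + X + X ^ 2 + X ^ 3 + X ^ 4 + X ^ 5 + X ^ 6) * (1 + X ^ 4) * (1 + X ^ 3 + X ^ 6))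
      (by decide) (by simp only [commonDen, List.map, List.prod_cons, List.prod_nil]; ring),
    mul_coneGF 9 [5, 4, 2] (Q := (1 - X) * (1 + X) * (1 + X + X ^ 2) ^ 2 * (1 + X ^ 2) * (1 - X + X ^ 2) * (1 + X + X ^ 2 + X ^ 3 + X ^ 4 + X ^ 5 + X ^ 6) * (1 + X ^ 4) * (1 + X ^ 3 + X ^ 6))
      (by decide) (by simp only [commonDen, List.map, List.prod_cons, List.prod_nil]; ring),
    mul_coneGF 12 [3, 5, 4] (Q := (1 - X) * (1 + X) ^ 2 * (1 + X + X ^ 2) * (1 + X ^ 2) * (1 - X + X ^ 2) * (1 + X + X ^ 2 + X ^ 3 + X ^ 4 + X ^ 5 + X ^ 6) * (1 + X ^ 4) * (1 + X ^ 3 + X ^ 6))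
      (by decide) (by simp only [commonDen, List.map, List.prod_cons, List.prod_nil]; ring),
    mul_coneGF 9 [4, 3, 2] (Q := (1 - X) * (1 + X) * (1 + X + X ^ 2) * (1 + X ^ 2) * (1 + X + X ^ 2 + X ^ 3 + X ^ 4) * (1 - X + X ^ 2) * (1 + X + X ^ 2 + X ^ 3 + X ^ 4 + X ^ 5 + X ^ 6) * (1 + X ^ 4) * (1 + X ^ 3 + X ^ 6))
      (by decide) (by simp only [commonDen, List.map, List.prod_cons, List.prod_nil]; ring)]
  ring

set_option maxHeartbeats 2000000 in
theorem commonDen_mul_weightGF_zero_g :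
    commonDen * weightGF weight (fun p => Admissible p ∧ p.2.1 = 0 ∧ 0 < p.2.2.1 ∧ 0 < p.1) =
      2 * X ^ 7 + 6 * X ^ 8 + 14 * X ^ 9 + 26 * X ^ 10 + 44 * X ^ 11 + 66 * X ^ 12 + 92 * X ^ 13
      + 118 * X ^ 14 + 142 * X ^ 15 + 158 * X ^ 16 + 164 * X ^ 17 + 156 * X ^ 18 + 134 * X ^ 19
      + 98 * X ^ 20 + 52 * X ^ 21 - 52 * X ^ 23 - 98 * X ^ 24 - 134 * X ^ 25 - 156 * X ^ 26 -
      164 * X ^ 27 - 158 * X ^ 28 - 142 * X ^ 29 - 118 * X ^ 30 - 92 * X ^ 31 - 66 * X ^ 32 - 44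
      * X ^ 33 - 26 * X ^ 34 - 14 * X ^ 35 - 6 * X ^ 36 - 2 * X ^ 37 := by
  rw [weightGF_zero_g]
  simp only [mul_add]
  rw [mul_coneGF 7 [4, 2, 1] (Q := (1 - X) * (1 + X) * (1 + X + X ^ 2) ^ 2 * (1 + X ^ 2) * (1 + X + X ^ 2 + X ^ 3 + X ^ 4) * (1 - X + X ^ 2) * (1 + X + X ^ 2 + X ^ 3 + X ^ 4 + X ^ 5 + X ^ 6) * (1 + X ^ 4) * (1 + X ^ 3 + X ^ 6))
      (by decide) (by simp only [commonDen, List.map, List.prod_cons, List.prod_nil]; ring)]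
  ring

set_option maxHeartbeats 2000000 in
theorem commonDen_mul_weightGF_zero_f_g :
    commonDen * weightGF weight (fun p => Admissible p ∧ p.2.2.1 = 0 ∧ p.2.1 = 0) =
      X ^ 3 + 3 * X ^ 4 + 7 * X ^ 5 + 13 * X ^ 6 + 21 * X ^ 7 + 30 * X ^ 8 + 39 * X ^ 9 + 46 * X
      ^ 10 + 49 * X ^ 11 + 46 * X ^ 12 + 36 * X ^ 13 + 19 * X ^ 14 - 4 * X ^ 15 - 30 * X ^ 16 -
      56 * X ^ 17 - 78 * X ^ 18 - 93 * X ^ 19 - 98 * X ^ 20 - 93 * X ^ 21 - 78 * X ^ 22 - 56 * X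
      ^ 23 - 30 * X ^ 24 - 4 * X ^ 25 + 19 * X ^ 26 + 36 * X ^ 27 + 46 * X ^ 28 + 49 * X ^ 29 +
      46 * X ^ 30 + 39 * X ^ 31 + 30 * X ^ 32 + 21 * X ^ 33 + 13 * X ^ 34 + 7 * X ^ 35 + 3 * X ^
      36 + X ^ 37 := by
  rw [weightGF_zero_f_g]
  rw [mul_coneGF 3 [2, 1] (Q := (1 - X) ^ 2 * (1 + X) ^ 2 * (1 + X + X ^ 2) ^ 2 * (1 + X ^ 2) ^ 2 * (1 + X + X ^ 2 + X ^ 3 + X ^ 4) * (1 - X + X ^ 2) * (1 + X + X ^ 2 + X ^ 3 + X ^ 4 + X ^ 5 + X ^ 6) * (1 + X ^ 4) * (1 + X ^ 3 + X ^ 6))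
      (by decide) (by simp only [commonDen, List.map, List.prod_cons, List.prod_nil]; ring)]
  ring

-- Single cones have poles at the primitive ninth roots of unity, from `1 - X ^ 9`. These cancel in
-- the sum, which is why `den` has no such factor; after multiplication by `commonDen` the claim is
-- a polynomial identity.
set_option maxHeartbeats 2000000 in
theorem den_mul_weightGF_admissible :
    den X * weightGF weight Admissible = X ^ 3 * numHatL X * (1 - X ^ 3) := by
  apply mul_left_cancel₀ commonDen_ne_zero
  rw [mul_left_comm, commonDen_mul_weightGF_admissible, den, numHatL, commonDen]
  ring

set_option maxHeartbeats 2000000 in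
theorem den_mul_weightGF_weighted :
    den X * (72 * weightGF weight Admissible
      - 36 * (weightGF weight (fun p => Admissible p ∧ p.2.2.1 = 0 ∧ 0 < p.2.1)
        + weightGF weight (fun p => Admissible p ∧ p.1 = 0 ∧ 0 < p.2.1 ∧ 0 < p.2.2.1)
        + weightGF weight (fun p => Admissible p ∧ p.2.1 = 0 ∧ 0 < p.2.2.1 ∧ 0 < p.1))
      - 60 * weightGF weight (fun p => Admissible p ∧ p.2.2.1 = 0 ∧ p.2.1 = 0)) =
      12 * X ^ 3 * numL X * (1 - X ^ 3) := by
  apply mul_left_cancel₀ commonDen_ne_zero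
  rw [mul_left_comm]
  simp only [mul_sub, mul_add, mul_left_comm commonDen]
  rw [commonDen_mul_weightGF_admissible, commonDen_mul_weightGF_zero_f,
    commonDen_mul_weightGF_zero_d, commonDen_mul_weightGF_zero_g,
    commonDen_mul_weightGF_zero_f_g, den, numL, commonDen]
  ring

/-! ### Invariance under symmetries, and existence of normal forms -/

theorem HasMagicSum.entries {x : Square} {t : ℕ} (h : HasMagicSum x t) :
    (x 0 0 + x 0 1 + x 0 2 = t ∧ x 1 0 + x 1 1 + x 1 2 = t ∧ x 2 0 + x 2 1 + x 2 2 = t) ∧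
      x 0 0 + x 1 0 + x 2 0 = t ∧ x 0 1 + x 1 1 + x 2 1 = t ∧ x 0 2 + x 1 2 + x 2 2 = t := by
  have h1 := h.1
  have h2 := h.2
  simp only [Fin.sum_univ_three] at h1 h2
  exact ⟨⟨h1 0, h1 1, h1 2⟩, h2 0, h2 1, h2 2⟩

theorem lineDistinct_iff {x : Square} : LineDistinct x ↔
    (∀ j, x j 0 ≠ x j 1 ∧ x j 0 ≠ x j 2 ∧ x j 1 ≠ x j 2) ∧
      ∀ k, x 0 k ≠ x 1 k ∧ x 0 k ≠ x 2 k ∧ x 1 k ≠ x 2 k := by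
  have key : ∀ v : Fin 3 → ℕ, Function.Injective v ↔ v 0 ≠ v 1 ∧ v 0 ≠ v 2 ∧ v 1 ≠ v 2 := by
    intro v
    constructor
    · intro h
      exact ⟨h.ne (by decide), h.ne (by decide), h.ne (by decide)⟩
    · rintro ⟨h1, h2, h3⟩ i j hij
      fin_cases i <;> fin_cases j <;> first | rfl | (exfalso; revert hij; simp; omega)
  exact and_congr (forall_congr' fun j => key _) (forall_congr' fun k => key _)

theorem finite_hasMagicSum (t : ℕ) : {x : Square | HasMagicSum x t}.Finite := by
  refine (Set.Finite.pi' fun _ : Fin 3 => Set.Finite.pi' fun _ : Fin 3 =>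
    Set.finite_Iic t).subset fun x hx j k => ?_
  exact (hx.1 j) ▸ Finset.single_le_sum (f := fun k => x j k) (fun _ _ => Nat.zero_le _)
    (Finset.mem_univ k)

section Symmetry

variable {x y : Square} {t : ℕ}

theorem HasMagicSum.submatrix (h : HasMagicSum x t) (σ τ : Equiv.Perm (Fin 3)) :
    HasMagicSum (x.submatrix σ τ) t :=
  ⟨fun j => (Equiv.sum_comp τ fun k => x (σ j) k).trans (h.1 _),
    fun k => (Equiv.sum_comp σ fun j => x j (τ k)).trans (h.2 _)⟩

theorem HasMagicSum.of_sameType (h : HasMagicSum x t) (hxy : SameType x y) : HasMagicSum y t := by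
  obtain ⟨σ, τ, rfl | rfl⟩ := hxy
  · exact h.submatrix σ τ
  · exact HasMagicSum.submatrix ⟨h.2, h.1⟩ σ τ

theorem LineDistinct.submatrix (h : LineDistinct x) (σ τ : Equiv.Perm (Fin 3)) :
    LineDistinct (x.submatrix σ τ) :=
  ⟨fun j => (h.1 (σ j)).comp τ.injective, fun k => (h.2 (τ k)).comp σ.injective⟩

theorem LineDistinct.of_sameType (h : LineDistinct x) (hxy : SameType x y) : LineDistinct y := by
  obtain ⟨σ, τ, rfl | rfl⟩ := hxy
  · exact h.submatrix σ τ
  · exact LineDistinct.submatrix ⟨h.2, h.1⟩ σ τ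

theorem SameType.exists_entry (hxy : SameType x y) (j k : Fin 3) : ∃ j' k', y j' k' = x j k := by
  obtain ⟨σ, τ, rfl | rfl⟩ := hxy
  · exact ⟨σ⁻¹ j, τ⁻¹ k, by simp⟩
  · exact ⟨σ⁻¹ k, τ⁻¹ j, by simp⟩

theorem magilatinSquares.of_sameType (hx : x ∈ magilatinSquares t) (hxy : SameType x y) :
    y ∈ magilatinSquares t := by
  refine ⟨fun j k => ?_, hx.2.1.of_sameType hxy, hx.2.2.of_sameType hxy⟩
  obtain ⟨j', k', h⟩ := (sameType_equivalence.symm hxy).exists_entry j k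
  exact h ▸ hx.1 j' k'

theorem reducedSquares.of_sameType (hx : x ∈ reducedSquares t) (hxy : SameType x y) :
    y ∈ reducedSquares t := by
  refine ⟨?_, hx.2.1.of_sameType hxy, hx.2.2.of_sameType hxy⟩
  obtain ⟨j, k, h⟩ := hx.1
  obtain ⟨j', k', h'⟩ := hxy.exists_entry j k
  exact ⟨j', k', h'.trans h⟩

/-- The squares selected to represent their symmetry types. -/
def IsNormal (x : Square) : Prop :=
  (∀ j k, x 0 0 ≤ x j k) ∧ x 0 1 < x 0 2 ∧ x 1 0 < x 2 0 ∧ x 0 1 ≤ x 1 0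

/-- A smallest entry is moved to the corner, the other two rows and the other two columns are sorted
along the first column and the first row, and a reflection puts the smaller of the two neighbours of
the corner into the first row. -/
theorem exists_sameType_isNormal (hx : LineDistinct x) : ∃ y, SameType x y ∧ IsNormal y := by
  obtain ⟨⟨i, j⟩, -, hmin⟩ :=
    Finset.exists_min_image Finset.univ (fun p : Fin 3 × Fin 3 => x p.1 p.2) ⟨(0, 0), by simp⟩
  have hmin' : ∀ k l, x i j ≤ x k l := fun k l => hmin (k, l) (Finset.mem_univ _)
  obtain ⟨σ, hσ, hσ'⟩ : ∃ σ : Equiv.Perm (Fin 3), σ 0 = i ∧ x (σ 1) j < x (σ 2) j := by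
    have hne : x (Equiv.swap 0 i 1) j ≠ x (Equiv.swap 0 i 2) j :=
      (hx.2 j).ne ((Equiv.swap 0 i).injective.ne (by decide))
    rcases hne.lt_or_gt with h | h
    · exact ⟨Equiv.swap 0 i, by simp, h⟩
    · refine ⟨Equiv.swap 0 i * Equiv.swap 1 2, ?_, ?_⟩
      · rw [Equiv.Perm.mul_apply, show Equiv.swap (1 : Fin 3) 2 0 = 0 by decide,
          Equiv.swap_apply_left]
      · simpa using h
  obtain ⟨τ, hτ, hτ'⟩ : ∃ τ : Equiv.Perm (Fin 3), τ 0 = j ∧ x i (τ 1) < x i (τ 2) := by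
    have hne : x i (Equiv.swap 0 j 1) ≠ x i (Equiv.swap 0 j 2) :=
      (hx.1 i).ne ((Equiv.swap 0 j).injective.ne (by decide))
    rcases hne.lt_or_gt with h | h
    · exact ⟨Equiv.swap 0 j, by simp, h⟩
    · refine ⟨Equiv.swap 0 j * Equiv.swap 1 2, ?_, ?_⟩
      · rw [Equiv.Perm.mul_apply, show Equiv.swap (1 : Fin 3) 2 0 = 0 by decide,
          Equiv.swap_apply_left]
      · simpa using h
  rcases le_total (x i (τ 1)) (x (σ 1) j) with h | h
  · refine ⟨x.submatrix σ τ, ⟨σ, τ, Or.inl rfl⟩, fun k l => ?_, ?_, ?_, ?_⟩ <;>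
      simp only [Matrix.submatrix_apply, hσ, hτ, hmin', hσ', hτ', h]
  · refine ⟨x.transpose.submatrix τ σ, ⟨τ, σ, Or.inr rfl⟩, fun k l => ?_, ?_, ?_, ?_⟩ <;>
      simp only [Matrix.submatrix_apply, Matrix.transpose_apply, hσ, hτ, hmin', hσ', hτ', h]

end Symmetry

/-! ### Parametrization and uniqueness of normal forms -/

/-- The square with parameters `(d, g, f, e)`. -/
def square : ℕ × ℕ × ℕ × ℕ → Square := fun (d, g, f, e) =>
  !![0, d + g, d + g + 2 * f + e; d + g + f, e + f + d, g; d + g + f + e, g + f, d]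

/-- The square `x` with `m` added to every entry. -/
def shift (m : ℕ) (x : Square) : Square := Matrix.of fun j k => m + x j k

theorem forall_fin_three {P : Fin 3 → Prop} : (∀ i, P i) ↔ P 0 ∧ P 1 ∧ P 2 := by
  simp [Fin.forall_fin_succ]

theorem square_hasMagicSum (p : ℕ × ℕ × ℕ × ℕ) : HasMagicSum (square p) (weight p) := by
  obtain ⟨d, g, f, e⟩ := p
  simp only [HasMagicSum, Fin.sum_univ_three, forall_fin_three, square, weight, Matrix.of_apply,
    Matrix.cons_val]
  omega

theorem square_lineDistinct {p : ℕ × ℕ × ℕ × ℕ} (hp : Admissible p) : LineDistinct (square p) := by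
  obtain ⟨d, g, f, e⟩ := p
  simp only [Admissible] at hp
  simp only [lineDistinct_iff, forall_fin_three, square, Matrix.of_apply, Matrix.cons_val]
  omega

theorem square_isNormal {p : ℕ × ℕ × ℕ × ℕ} (hp : Admissible p) : IsNormal (square p) := by
  obtain ⟨d, g, f, e⟩ := p
  simp only [Admissible] at hp
  simp only [IsNormal, forall_fin_three, square, Matrix.of_apply, Matrix.cons_val]
  omega

theorem square_mem_reducedSquares {p : ℕ × ℕ × ℕ × ℕ} (hp : Admissible p) :
    square p ∈ reducedSquares (weight p) :=
  ⟨⟨0, 0, rfl⟩, square_hasMagicSum p, square_lineDistinct hp⟩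

theorem IsNormal.exists_shift_square {x : Square} {t : ℕ} (hx : IsNormal x) (hl : LineDistinct x)
    (hs : HasMagicSum x t) : ∃ m p, Admissible p ∧ x = shift m (square p) := by
  rw [lineDistinct_iff] at hl
  have hs := hs.entries
  simp only [IsNormal, forall_fin_three] at hx hl
  -- All four differences are nonnegative by normality. The remaining entries follow from the sums;
  -- for instance, comparing the first row with the last column gives `x 0 0 + x 0 1 = x 1 2 + x 2
  -- 2`.
  refine ⟨x 0 0, (x 2 2 - x 0 0, x 1 2 - x 0 0, x 1 0 - x 0 1, x 2 0 - x 1 0), ?_, ?_⟩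
  · simp only [Admissible]
    omega
  · refine Matrix.ext (forall_fin_three.2 ⟨forall_fin_three.2 ?_, forall_fin_three.2 ?_,
      forall_fin_three.2 ?_⟩) <;>
    simp only [shift, square, Matrix.of_apply, Matrix.cons_val] <;> omega

theorem perm_fin_three (σ : Equiv.Perm (Fin 3)) :
    (σ 0 = 0 ∧ σ 1 = 1 ∧ σ 2 = 2) ∨ (σ 0 = 0 ∧ σ 1 = 2 ∧ σ 2 = 1) ∨
    (σ 0 = 1 ∧ σ 1 = 0 ∧ σ 2 = 2) ∨ (σ 0 = 1 ∧ σ 1 = 2 ∧ σ 2 = 0) ∨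
    (σ 0 = 2 ∧ σ 1 = 0 ∧ σ 2 = 1) ∨ (σ 0 = 2 ∧ σ 1 = 1 ∧ σ 2 = 0) := by
  revert σ
  decide

theorem perm_eq_one_iff (σ : Equiv.Perm (Fin 3)) : σ = 1 ↔ σ 0 = 0 ∧ σ 1 = 1 ∧ σ 2 = 2 := by
  revert σ
  decide

/-- Two facts from one check of 36 pairs of permutations. The equality of parameters gives
uniqueness of the normal form; the alternative at the end says that the stabilizer in the group of
row and column permutations is trivial except for Latin squares. -/
theorem submatrix_shift_square {m m' d g f e d' g' f' e' : ℕ} (hp : Admissible (d, g, f, e))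
    (hp' : Admissible (d', g', f', e')) {σ τ : Equiv.Perm (Fin 3)}
    (h : shift m' (square (d', g', f', e')) = (shift m (square (d, g, f, e))).submatrix σ τ) :
    (m' = m ∧ d' = d ∧ g' = g ∧ f' = f ∧ e' = e) ∧ (σ = 1 ∧ τ = 1 ∨ f = 0 ∧ g = 0) := by
  have h' : ∀ j k, shift m' (square (d', g', f', e')) j k =
    shift m (square (d, g, f, e)) (σ j) (τ k) := fun j k => by rw [h]; rfl
  clear h
  simp only [forall_fin_three] at h'
  simp only [perm_eq_one_iff]
  simp only [Admissible] at hp hp'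
  rcases perm_fin_three σ with hσ | hσ | hσ | hσ | hσ | hσ <;>
  rcases perm_fin_three τ with hτ | hτ | hτ | hτ | hτ | hτ <;>
  simp only [hσ, hτ, shift, square, Matrix.of_apply, Matrix.cons_val, Fin.reduceEq,
    and_false, and_true, and_self, false_or, true_or] at h' ⊢ <;>
  omega

/-- The reflected counterpart. It also shows that a normal square can be equivalent to its transpose
under row and column permutations only if one of `f`, `g`, `d` is zero. -/
theorem transpose_submatrix_shift_square {m m' d g f e d' g' f' e' : ℕ}
    (hp : Admissible (d, g, f, e)) (hp' : Admissible (d', g', f', e')) {σ τ : Equiv.Perm (Fin 3)}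
    (h : shift m' (square (d', g', f', e')) =
      (shift m (square (d, g, f, e))).transpose.submatrix σ τ) :
    (m' = m ∧ d' = d ∧ g' = g ∧ f' = f ∧ e' = e) ∧ (f = 0 ∨ g = 0 ∨ d = 0) := by
  have h' : ∀ j k, shift m' (square (d', g', f', e')) j k =
    shift m (square (d, g, f, e)) (τ k) (σ j) := fun j k => by rw [h]; rfl
  clear h
  simp only [forall_fin_three] at h'
  simp only [Admissible] at hp hp'
  rcases perm_fin_three σ with hσ | hσ | hσ | hσ | hσ | hσ <;>
  rcases perm_fin_three τ with hτ | hτ | hτ | hτ | hτ | hτ <;>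
  simp only [hσ, hτ, shift, square, Matrix.of_apply, Matrix.cons_val] at h' <;>
  omega

theorem shift_zero (x : Square) : shift 0 x = x := by
  ext j k
  simp [shift]

theorem square_injective_of_admissible {p q : ℕ × ℕ × ℕ × ℕ} (hp : Admissible p)
    (hq : Admissible q) (h : SameType (square p) (square q)) : p = q := by
  obtain ⟨d, g, f, e⟩ := p
  obtain ⟨d', g', f', e'⟩ := q
  obtain ⟨σ, τ, h⟩ := h
  rw [← shift_zero (square (d, g, f, e)), ← shift_zero (square (d', g', f', e'))] at h
  rcases h with h | h
  · obtain ⟨⟨-, rfl, rfl, rfl, rfl⟩, -⟩ := submatrix_shift_square hp hq h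
    rfl
  · obtain ⟨⟨-, rfl, rfl, rfl, rfl⟩, -⟩ := transpose_submatrix_shift_square hp hq h
    rfl

theorem IsNormal.eq_of_sameType {x y : Square} {t : ℕ} (hx : IsNormal x) (hy : IsNormal y)
    (hl : LineDistinct x) (hs : HasMagicSum x t) (h : SameType x y) : x = y := by
  obtain ⟨m', ⟨d', g', f', e'⟩, hp', rfl⟩ :=
    hy.exists_shift_square (hl.of_sameType h) (hs.of_sameType h)
  obtain ⟨m, ⟨d, g, f, e⟩, hp, rfl⟩ := hx.exists_shift_square hl hs
  obtain ⟨σ, τ, h | h⟩ := h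
  · obtain ⟨⟨rfl, rfl, rfl, rfl, rfl⟩, -⟩ := submatrix_shift_square hp hp' h
    rfl
  · obtain ⟨⟨rfl, rfl, rfl, rfl, rfl⟩, -⟩ := transpose_submatrix_shift_square hp hp' h
    rfl

/-! ### Counting types by normal forms, and reduction to smallest entry zero -/

theorem typeCount_eq {S : Set Square} {t : ℕ} (hl : ∀ x ∈ S, LineDistinct x)
    (hs : ∀ x ∈ S, HasMagicSum x t) (hS : ∀ x ∈ S, ∀ y, SameType x y → y ∈ S) :
    typeCount S = (S ∩ {x | IsNormal x}).ncard := by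
  rw [typeCount, ← Nat.card_coe_set_eq]
  symm
  refine Nat.card_eq_of_bijective
    (fun x : ↥(S ∩ {x | IsNormal x}) => Quotient.mk (typeSetoid S) ⟨x.1, x.2.1⟩) ⟨?_, ?_⟩
  · intro x y h
    exact Subtype.ext (IsNormal.eq_of_sameType x.2.2 y.2.2 (hl _ x.2.1) (hs _ x.2.1)
      (Quotient.exact h))
  · intro q
    induction q using Quotient.inductionOn with
    | h x =>
      obtain ⟨y, hxy, hy⟩ := exists_sameType_isNormal (hl _ x.2)
      exact ⟨⟨y, hS _ x.2 y hxy, hy⟩, Quotient.sound (sameType_equivalence.symm hxy)⟩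

theorem hatL_eq (t : ℕ) : hatL t = (magilatinSquares t ∩ {x | IsNormal x}).ncard :=
  typeCount_eq (fun _ hx => hx.2.2) (fun _ hx => hx.2.1) fun _ hx _ => magilatinSquares.of_sameType hx

theorem hatR_eq (t : ℕ) : hatR t = (reducedSquares t ∩ {x | IsNormal x}).ncard :=
  typeCount_eq (fun _ hx => hx.2.2) (fun _ hx => hx.2.1) fun _ hx _ => reducedSquares.of_sameType hx

/-- Subtracting 1 from all entries of a positive square leaves a square that either contains a zero
or is still positive. The predicate `N` lets one argument serve for all squares and for normal
squares. -/
theorem ncard_magilatinSquares_add_three (t : ℕ) {N : Square → Prop}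
    (hN : ∀ x, N (shift 1 x) ↔ N x) :
    (magilatinSquares (t + 3) ∩ {x | N x}).ncard =
      (reducedSquares t ∩ {x | N x}).ncard + (magilatinSquares t ∩ {x | N x}).ncard := by
  have hfin := finite_hasMagicSum t
  rw [← Set.ncard_union_eq
    (Set.disjoint_left.2 fun x hx hx' => by
      obtain ⟨j, k, h⟩ := hx.1.1
      exact (hx'.1.1 j k).ne' h)
    (hfin.subset fun x hx => hx.1.2.1) (hfin.subset fun x hx => hx.1.2.1)]
  symm
  have hinj : Function.Injective (shift 1) := fun x y h => by
    ext j k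
    simpa [shift] using congrFun (congrFun h j) k
  rw [← Set.ncard_image_of_injective _ hinj]
  congr 1
  have hsum : ∀ x : Square, HasMagicSum (shift 1 x) (t + 3) ↔ HasMagicSum x t := fun x => by
    simp only [HasMagicSum, shift, Matrix.of_apply, Finset.sum_add_distrib]
    simp [add_comm t 3]
  have hline : ∀ x : Square, LineDistinct (shift 1 x) ↔ LineDistinct x := fun x => by
    simp [lineDistinct_iff, shift]
  ext x
  constructor
  · rintro ⟨y, hy | hy, rfl⟩ <;>
    exact ⟨⟨fun j k => by simp [shift], (hsum y).2 hy.1.2.1, (hline y).2 hy.1.2.2⟩, (hN y).2 hy.2⟩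
  · rintro ⟨⟨hpos, hs, hl⟩, hx⟩
    obtain ⟨y, rfl⟩ : ∃ y, shift 1 y = x := by
      refine ⟨Matrix.of fun j k => x j k - 1, ?_⟩
      ext j k
      have := hpos j k
      simp only [shift, Matrix.of_apply]
      omega
    refine ⟨y, ?_, rfl⟩
    by_cases h0 : ∃ j k, y j k = 0
    · exact Or.inl ⟨⟨h0, (hsum y).1 hs, (hline y).1 hl⟩, (hN y).1 hx⟩
    · push Not at h0
      exact Or.inr ⟨⟨fun j k => Nat.pos_of_ne_zero (h0 j k), (hsum y).1 hs, (hline y).1 hl⟩,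
        (hN y).1 hx⟩

theorem L_add_three (t : ℕ) : L (t + 3) = R t + L t := by
  simpa [L, R] using ncard_magilatinSquares_add_three t (N := fun _ => True) fun _ => Iff.rfl

theorem hatL_add_three (t : ℕ) : hatL (t + 3) = hatR t + hatL t := by
  rw [hatL_eq, hatL_eq, hatR_eq]
  exact ncard_magilatinSquares_add_three t fun x => by
    simp [IsNormal, shift]

theorem magilatinSquares_eq_empty {t : ℕ} (ht : t < 3) : magilatinSquares t = ∅ := by
  rw [Set.eq_empty_iff_forall_notMem]
  rintro x ⟨hpos, hs, -⟩
  have := hs.entries.1.1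
  have h0 := hpos 0 0
  have h1 := hpos 0 1
  have h2 := hpos 0 2
  omega

theorem L_of_lt {t : ℕ} (ht : t < 3) : L t = 0 := by
  rw [L, magilatinSquares_eq_empty ht, Set.ncard_empty]

theorem hatL_of_lt {t : ℕ} (ht : t < 3) : hatL t = 0 := by
  rw [hatL_eq, magilatinSquares_eq_empty ht, Set.empty_inter, Set.ncard_empty]

theorem reducedSquares_zero : reducedSquares 0 = ∅ := by
  rw [Set.eq_empty_iff_forall_notMem]
  rintro x ⟨-, hs, hl⟩
  have := hs.entries.1.1
  have h1 := ((lineDistinct_iff.1 hl).1 0).1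
  omega

theorem genFun_add_three {f r : ℕ → ℕ} (h : ∀ t, f (t + 3) = r t + f t) (hf : ∀ t < 3, f t = 0)
    (hr : r 0 = 0) : genFun f = X ^ 3 * (1 - X ^ 3)⁻¹ * genFun r := by
  have key : genFun f * (1 - X ^ 3) = X ^ 3 * genFun r := by
    ext t
    rw [mul_sub, mul_one, mul_comm, map_sub, coeff_X_pow_mul', coeff_X_pow_mul']
    simp only [genFun, coeff_mk]
    split_ifs with h0 h1 h2 h3
    · omega
    · omega
    · simp
    · have : t = 3 := by omega
      subst this
      simp [h 0, hf, hr]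
    · obtain ⟨s, rfl⟩ := Nat.exists_eq_add_of_le' h3
      simp [h s]
    · simp [hf t (by omega)]
  linear_combination (1 - X ^ 3)⁻¹ * key -
    genFun f * one_sub_X_pow_mul_inv (by decide : 0 < 3)

theorem ncard_reducedSquares_inter_isNormal (s : ℕ) :
    {p | Admissible p ∧ weight p = s}.ncard = (reducedSquares s ∩ {x | IsNormal x}).ncard := by
  refine Set.ncard_congr (fun p _ => square p) ?_ ?_ ?_
  · rintro p ⟨hp, rfl⟩
    exact ⟨square_mem_reducedSquares hp, square_isNormal hp⟩
  · rintro p q ⟨hp, -⟩ ⟨hq, -⟩ h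
    exact square_injective_of_admissible hp hq (h ▸ sameType_equivalence.refl _)
  · rintro x ⟨⟨⟨j, k, h0⟩, hs, hl⟩, hx⟩
    obtain ⟨m, p, hp, rfl⟩ := hx.exists_shift_square hl hs
    obtain rfl : m = 0 := by
      simp only [shift, Matrix.of_apply] at h0
      omega
    rw [shift_zero] at hs ⊢
    exact ⟨p, ⟨hp, ((square_hasMagicSum p).1 0).symm.trans (hs.1 0)⟩, rfl⟩

theorem weightGF_admissible_eq_genFun : weightGF weight Admissible = genFun hatR := by
  ext s
  simp only [weightGF, genFun, coeff_mk]
  rw [ncard_reducedSquares_inter_isNormal, ← hatR_eq]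
  split_ifs with h
  · subst h
    rw [hatR_eq, reducedSquares_zero]
    simp
  · rfl

/-! ### Orbit sizes -/

theorem submatrix_eq_submatrix_iff {x y : Square} {σ τ σ' τ' : Equiv.Perm (Fin 3)} :
    x.submatrix σ τ = y.submatrix σ' τ' ↔ x = y.submatrix ⇑(σ' * σ⁻¹) ⇑(τ' * τ⁻¹) := by
  constructor
  · intro h
    ext j k
    simpa using congrFun (congrFun h (σ⁻¹ j)) (τ⁻¹ k)
  · rintro rfl
    ext j k
    simp

theorem square_submatrix_injective {d g f e : ℕ} (hp : Admissible (d, g, f, e))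
    (h0 : ¬ (f = 0 ∧ g = 0)) : Function.Injective
      fun s : Equiv.Perm (Fin 3) × Equiv.Perm (Fin 3) =>
        (square (d, g, f, e)).submatrix s.1 s.2 := by
  rintro ⟨σ, τ⟩ ⟨σ', τ'⟩ h
  have h := submatrix_eq_submatrix_iff.1 h
  rw [← shift_zero (square _)] at h
  obtain ⟨h1, h2⟩ := (submatrix_shift_square hp hp h).2.resolve_right h0
  rw [Prod.mk.injEq]
  exact ⟨(mul_inv_eq_one.1 h1).symm, (mul_inv_eq_one.1 h2).symm⟩

/-- The orbit is the union of two sets of 36 squares, the permuted squares and their transposes. A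
common element would make the square equivalent to its transpose by permutations alone. -/
theorem ncard_type_of_pos {d g f e : ℕ} (hp : Admissible (d, g, f, e)) (hf : f ≠ 0) (hg : g ≠ 0)
    (hd : d ≠ 0) : {y | SameType (square (d, g, f, e)) y}.ncard = 72 := by
  set x := square (d, g, f, e) with hx
  have hrange : {y | SameType x y} = Set.range
      (fun s : Equiv.Perm (Fin 3) × Equiv.Perm (Fin 3) => x.submatrix s.1 s.2) ∪
      Set.range fun s : Equiv.Perm (Fin 3) × Equiv.Perm (Fin 3) =>
        (x.submatrix s.1 s.2).transpose := by
    ext y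
    constructor
    · rintro ⟨σ, τ, rfl | rfl⟩
      · exact Or.inl ⟨(σ, τ), rfl⟩
      · exact Or.inr ⟨(τ, σ), rfl⟩
    · rintro (⟨s, rfl⟩ | ⟨s, rfl⟩)
      · exact ⟨s.1, s.2, Or.inl rfl⟩
      · exact ⟨s.2, s.1, Or.inr rfl⟩
  have hinj := square_submatrix_injective hp fun h => hf h.1
  have hcard : Nat.card (Equiv.Perm (Fin 3) × Equiv.Perm (Fin 3)) = 36 := by
    rw [Nat.card_eq_fintype_card]
    rfl
  rw [hrange, Set.ncard_union_eq ?_ (Set.finite_range _) (Set.finite_range _),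
    Set.ncard_range_of_injective hinj,
    Set.ncard_range_of_injective fun _ _ h => hinj (Matrix.transpose_injective h), hcard]
  rw [Set.disjoint_left]
  rintro _ ⟨⟨σ, τ⟩, rfl⟩ ⟨⟨σ', τ'⟩, h⟩
  have h : x.submatrix σ τ = x.transpose.submatrix τ' σ' := h.symm
  rw [submatrix_eq_submatrix_iff, hx, ← shift_zero (square _)] at h
  have := (transpose_submatrix_shift_square hp hp h).2
  omega

theorem exists_transpose_square_eq {d g f e : ℕ} (h : f = 0 ∨ g = 0 ∨ d = 0) :
    ∃ α β : Equiv.Perm (Fin 3),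
      (square (d, g, f, e)).transpose = (square (d, g, f, e)).submatrix α β := by
  obtain ⟨α, β, h'⟩ : ∃ α β : Equiv.Perm (Fin 3),
      ∀ j k, square (d, g, f, e) (α j) (β k) = square (d, g, f, e) k j := by
    simp only [forall_fin_three]
    -- For `f = 0` the square is symmetric. For `g = 0` or `d = 0` there is a second zero, at `(1,
    -- 2)` or `(2, 2)`, and the permutations carry it to the corner.
    rcases h with rfl | rfl | rfl
    · refine ⟨1, 1, ?_⟩
      simp [square]
    · obtain ⟨α, hα⟩ : ∃ α : Equiv.Perm (Fin 3), α 0 = 1 ∧ α 1 = 2 ∧ α 2 = 0 := by decide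
      obtain ⟨β, hβ⟩ : ∃ β : Equiv.Perm (Fin 3), β 0 = 2 ∧ β 1 = 0 ∧ β 2 = 1 := by decide
      refine ⟨α, β, ?_⟩
      simp [hα, hβ, square]
      omega
    · obtain ⟨α, hα⟩ : ∃ α : Equiv.Perm (Fin 3), α 0 = 2 ∧ α 1 = 1 ∧ α 2 = 0 := by decide
      refine ⟨α, α, ?_⟩
      simp [hα, square]
  exact ⟨α, β, by ext j k; exact (h' j k).symm⟩

theorem setOf_sameType_of_symm {d g f e : ℕ} (h : f = 0 ∨ g = 0 ∨ d = 0) :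
    {y | SameType (square (d, g, f, e)) y} = Set.range
      fun s : Equiv.Perm (Fin 3) × Equiv.Perm (Fin 3) =>
        (square (d, g, f, e)).submatrix s.1 s.2 := by
  ext y
  constructor
  · rintro ⟨σ, τ, rfl | rfl⟩
    · exact ⟨(σ, τ), rfl⟩
    · obtain ⟨α, β, h⟩ := exists_transpose_square_eq (e := e) h
      exact ⟨(α * σ, β * τ), by rw [h]; rfl⟩
  · rintro ⟨s, rfl⟩
    exact ⟨s.1, s.2, Or.inl rfl⟩

theorem ncard_type_of_symm {d g f e : ℕ} (hp : Admissible (d, g, f, e))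
    (h : f = 0 ∨ g = 0 ∨ d = 0) (h0 : ¬ (f = 0 ∧ g = 0)) :
    {y | SameType (square (d, g, f, e)) y}.ncard = 36 := by
  rw [setOf_sameType_of_symm h, Set.ncard_range_of_injective (square_submatrix_injective hp h0),
    Nat.card_eq_fintype_card]
  rfl

/-- With `f = g = 0` the square is the addition table of `ℤ/3` with relabelled entries. A
translation of the columns equals a translation of the rows, so column permutations matter only
modulo translations: `6 * 2 = 12`. -/
theorem ncard_type_of_latin {d e : ℕ} (hp : Admissible (d, 0, 0, e)) :
    {y | SameType (square (d, 0, 0, e)) y}.ncard = 12 := by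
  simp only [Admissible] at hp
  let v : Fin 3 → ℕ := ![0, d, d + e]
  have hv : Function.Injective v := by
    intro i j
    fin_cases i <;> fin_cases j <;> simp [v] <;> omega
  have hx : ∀ j k, square (d, 0, 0, e) j k = v (j + k) := by
    simp only [forall_fin_three]
    simp [square, v, show (1 + 1 : Fin 3) = 2 by decide, show (1 + 2 : Fin 3) = 0 by decide,
      show (2 + 1 : Fin 3) = 0 by decide, show (2 + 2 : Fin 3) = 1 by decide, add_comm]
  let ε : Bool → Equiv.Perm (Fin 3) := fun b => if b then Equiv.swap 1 2 else 1
  have hrange : {y | SameType (square (d, 0, 0, e)) y} =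
      Set.range fun s : Equiv.Perm (Fin 3) × Bool =>
        (square (d, 0, 0, e)).submatrix s.1 (ε s.2) := by
    rw [setOf_sameType_of_symm (Or.inl rfl)]
    ext y
    constructor
    · rintro ⟨⟨σ, τ⟩, rfl⟩
      -- Every permutation of `ℤ/3` is affine, and `Equiv.swap 1 2` is negation. The translation
      -- part is then absorbed into the row permutation.
      obtain ⟨b, hb⟩ : ∃ b, ∀ k, τ k = τ 0 + ε b k := by
        revert τ
        decide
      refine ⟨(Equiv.addRight (τ 0) * σ, b), ?_⟩
      ext j k
      simp only [Matrix.submatrix_apply, hx, hb k]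
      simp [add_assoc]
    · rintro ⟨s, rfl⟩
      exact ⟨(s.1, ε s.2), rfl⟩
  rw [hrange, Set.ncard_range_of_injective, Nat.card_eq_fintype_card]
  · rfl
  · rintro ⟨σ, b⟩ ⟨σ', b'⟩ h
    have h' : ∀ j k, σ j + ε b k = σ' j + ε b' k := fun j k => by
      have := congrFun (congrFun h j) k
      simp only [Matrix.submatrix_apply, hx] at this
      exact hv this
    have hε : ∀ b, ε b 0 = 0 := by decide
    have hσ : σ = σ' := Equiv.ext fun j => by simpa [hε] using h' j 0
    subst hσ
    have hb : ε b 1 = ε b' 1 := by simpa using h' 0 1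
    have : b = b' := by
      clear hp h h'
      revert b b'
      decide
    rw [this]

theorem exists_square_eq {x : Square} {s : ℕ} (hr : x ∈ reducedSquares s) (hx : IsNormal x) :
    ∃ p ∈ (finiteFibers_weight.finite Admissible s).toFinset, square p = x := by
  obtain ⟨⟨j, k, h0⟩, hs, hl⟩ := hr
  obtain ⟨m, p, hp, rfl⟩ := hx.exists_shift_square hl hs
  obtain rfl : m = 0 := by
    simp only [shift, Matrix.of_apply] at h0
    omega
  rw [shift_zero] at hs ⊢
  exact ⟨p, (Set.Finite.mem_toFinset _).2
    ⟨hp, ((square_hasMagicSum p).1 0).symm.trans (hs.1 0)⟩, rfl⟩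

/-- The reduced squares are partitioned into types, and each type contains exactly one `square p`
with `p` admissible. -/
theorem R_eq_sum (s : ℕ) : R s = ∑ p ∈ (finiteFibers_weight.finite Admissible s).toFinset,
    {y | SameType (square p) y}.ncard := by
  classical
  have hfin : (reducedSquares s).Finite := (finite_hasMagicSum s).subset fun x hx => hx.2.1
  have hmem : ∀ p ∈ (finiteFibers_weight.finite Admissible s).toFinset, Admissible p ∧
      {y | SameType (square p) y} ⊆ reducedSquares s := by
    intro p hp
    rw [Set.Finite.mem_toFinset] at hp
    obtain ⟨hp, rfl⟩ := hp
    exact ⟨hp, fun y hy => reducedSquares.of_sameType (square_mem_reducedSquares hp) hy⟩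
  have hcard : ∀ p ∈ (finiteFibers_weight.finite Admissible s).toFinset,
      {y | SameType (square p) y}.ncard =
        (hfin.toFinset.filter fun y => SameType (square p) y).card := fun p hp => by
    rw [← Set.ncard_coe_finset]
    congr 1
    ext y
    simp only [Set.mem_ofPred_eq, Finset.coe_filter, Set.Finite.mem_toFinset]
    exact ⟨fun hy => ⟨(hmem p hp).2 hy, hy⟩, fun hy => hy.2⟩
  rw [Finset.sum_congr rfl hcard, ← Finset.card_biUnion, R, Set.ncard_eq_toFinset_card _ hfin]
  · congr 1
    ext y
    rw [Finset.mem_biUnion]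
    simp only [Finset.mem_filter]
    rw [Set.Finite.mem_toFinset]
    refine ⟨fun hy => ?_, fun ⟨_, _, hy, _⟩ => hy⟩
    obtain ⟨x, hyx, hx⟩ := exists_sameType_isNormal hy.2.2
    obtain ⟨p, hp, rfl⟩ := exists_square_eq (reducedSquares.of_sameType hy hyx) hx
    exact ⟨p, hp, hy, sameType_equivalence.symm hyx⟩
  · intro p hp q hq hpq
    rw [Function.onFun, Finset.disjoint_left]
    intro y hy hy'
    rw [Finset.mem_filter] at hy hy'
    exact hpq (square_injective_of_admissible (hmem p hp).1 (hmem q hq).1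
      (sameType_equivalence.trans hy.2 (sameType_equivalence.symm hy'.2)))

theorem coeff_weightGF_and (s : ℕ) (c : ℕ × ℕ × ℕ × ℕ → Prop) [DecidablePred c] :
    coeff s (weightGF weight fun p => Admissible p ∧ c p) =
      ∑ p ∈ (finiteFibers_weight.finite Admissible s).toFinset, if c p then (1 : ℚ) else 0 := by
  rw [Finset.sum_boole, weightGF, coeff_mk, ← Set.ncard_coe_finset]
  congr 2
  ext p
  simp only [Set.mem_ofPred_eq, Finset.coe_filter, Set.Finite.mem_toFinset]
  tauto

/-- Orbit sizes as corrections to 72: a single vanishing parameter costs 36, and the Latin case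
costs 60 since `72 - 60 = 12`. -/
theorem weightGF_weighted_eq_genFun :
    72 * weightGF weight Admissible
      - 36 * (weightGF weight (fun p => Admissible p ∧ p.2.2.1 = 0 ∧ 0 < p.2.1)
        + weightGF weight (fun p => Admissible p ∧ p.1 = 0 ∧ 0 < p.2.1 ∧ 0 < p.2.2.1)
        + weightGF weight (fun p => Admissible p ∧ p.2.1 = 0 ∧ 0 < p.2.2.1 ∧ 0 < p.1))
      - 60 * weightGF weight (fun p => Admissible p ∧ p.2.2.1 = 0 ∧ p.2.1 = 0) = genFun R := by
  have hA : weightGF weight Admissible = weightGF weight fun p => Admissible p ∧ True := by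
    simp only [and_true]
  rw [hA]
  have hnum : ∀ (n : ℕ) [n.AtLeastTwo], (OfNat.ofNat n : PowerSeries ℚ) = C (OfNat.ofNat n : ℚ) :=
    fun n _ => (map_ofNat C n).symm
  ext s
  rw [hnum 72, hnum 36, hnum 60]
  simp only [map_sub, map_add, coeff_C_mul, coeff_weightGF_and]
  rw [← Finset.sum_add_distrib, ← Finset.sum_add_distrib, Finset.mul_sum, Finset.mul_sum,
    Finset.mul_sum, ← Finset.sum_sub_distrib, ← Finset.sum_sub_distrib, genFun, coeff_mk]
  trans (R s : ℚ)
  · rw [R_eq_sum, Nat.cast_sum]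
    refine Finset.sum_congr rfl ?_
    rintro ⟨d, g, f, e⟩ hp
    rw [Set.Finite.mem_toFinset] at hp
    have hp := hp.1
    have hp' := hp
    simp only [Admissible] at hp'
    by_cases hf : f = 0 <;> by_cases hg : g = 0
    · subst hf hg
      rw [ncard_type_of_latin hp]
      norm_num
    all_goals by_cases hd : d = 0
    -- The contradictory cases are those where `d` vanishes together with `f` or with `g`.
    all_goals first
      | (exfalso; omega)
      | rw [ncard_type_of_pos hp hf hg hd]
      | rw [ncard_type_of_symm hp (by omega) (by omega)]
    all_goals simp [hf, hg, hd, Nat.pos_iff_ne_zero]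
    all_goals norm_num
  · split_ifs with h
    · subst h
      simp [R, reducedSquares_zero]
    · rfl

/-! ### The rational generating functions -/

theorem den_ne_zero : den X ≠ 0 := fun h => by
  simpa [den] using congrArg (constantCoeff (R := ℚ)) h

theorem den_mul_inv : den X * (den X)⁻¹ = 1 :=
  PowerSeries.mul_inv_cancel _ (by simp [den])

theorem genFun_L : genFun L = X ^ 3 * (1 - X ^ 3)⁻¹ * genFun R :=
  genFun_add_three L_add_three (fun _ => L_of_lt) (by rw [R, reducedSquares_zero, Set.ncard_empty])

theorem genFun_hatL : genFun hatL = X ^ 3 * (1 - X ^ 3)⁻¹ * genFun hatR :=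
  genFun_add_three hatL_add_three (fun _ => hatL_of_lt)
    (by rw [hatR_eq, reducedSquares_zero, Set.empty_inter, Set.ncard_empty])

theorem den_mul_genFun_L : den X * genFun L = 12 * X ^ 6 * numL X := by
  have h := den_mul_weightGF_weighted
  rw [weightGF_weighted_eq_genFun] at h
  rw [genFun_L]
  linear_combination X ^ 3 * (1 - X ^ 3)⁻¹ * h +
    12 * X ^ 6 * numL X * one_sub_X_pow_mul_inv (by decide : 0 < 3)

theorem den_mul_genFun_hatL : den X * genFun hatL = X ^ 6 * numHatL X := by
  have h := den_mul_weightGF_admissible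
  rw [weightGF_admissible_eq_genFun] at h
  rw [genFun_hatL]
  linear_combination X ^ 3 * (1 - X ^ 3)⁻¹ * h +
    X ^ 6 * numHatL X * one_sub_X_pow_mul_inv (by decide : 0 < 3)

/-! ### From generating functions to quasipolynomials -/

/-- The coefficients of the product of a polynomial, given by its list of coefficients, with the
generating function of a sequence. -/
def convolve (q : ℕ → ℚ) : List ℤ → ℕ → ℚ
  | [], _ => 0
  | c :: _, 0 => c * q 0
  | c :: l, n + 1 => c * q (n + 1) + convolve q l n

/-- The power series with a given list of coefficients. -/
noncomputable def listSeries : List ℤ → PowerSeries ℚ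
  | [] => 0
  | c :: l => (c : PowerSeries ℚ) + X * listSeries l

theorem coeff_intCast_mul (c : ℤ) (F : PowerSeries ℚ) (n : ℕ) :
    coeff n ((c : PowerSeries ℚ) * F) = c * coeff n F := by
  rw [← map_intCast (C (R := ℚ)), coeff_C_mul]

theorem coeff_listSeries_mul (q : ℕ → ℚ) (l : List ℤ) (n : ℕ) :
    coeff n (listSeries l * PowerSeries.mk q) = convolve q l n := by
  induction l generalizing n with
  | nil => simp [listSeries, convolve]
  | cons c l ih =>
    rw [listSeries, add_mul, map_add, coeff_intCast_mul, coeff_mk, mul_assoc]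
    cases n with
    | zero => simp [convolve]
    | succ n => rw [coeff_succ_X_mul, ih, convolve]

theorem coeff_listSeries (l : List ℤ) (n : ℕ) : coeff n (listSeries l) = (l.getD n 0 : ℤ) := by
  induction l generalizing n with
  | nil => simp [listSeries]
  | cons c l ih =>
    rw [listSeries, map_add, ← mul_one (c : PowerSeries ℚ), coeff_intCast_mul]
    cases n with
    | zero => simp
    | succ n => simp [coeff_succ_X_mul, ih, coeff_one]

theorem convolve_linear (a b : ℚ) (q r : ℕ → ℚ) (l : List ℤ) (n : ℕ) :
    convolve (fun t => a * q t + b * r t) l n = a * convolve q l n + b * convolve r l n := by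
  induction l generalizing n with
  | nil => simp [convolve]
  | cons c l ih =>
    cases n with
    | zero => simp only [convolve]; ring
    | succ n => simp only [convolve, ih]; ring

/-- `convolve` drops the terms with negative index. The bound on the length says that nothing is
dropped at `n`, which is what makes it commute with shifts. -/
theorem convolve_shift (a : ℕ) (q : ℕ → ℚ) {l : List ℤ} {n : ℕ} (hn : l.length ≤ n + 1) :
    convolve (fun t => q (t + a)) l n = convolve q l (n + a) := by
  induction l generalizing n with
  | nil => simp [convolve]
  | cons c l ih =>
    cases n with
    | zero =>
      have : l = [] := by simpa using hn
      subst this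
      cases a with
      | zero => simp [convolve]
      | succ a => simp [convolve]
    | succ n =>
      have : n + 1 + a = n + a + 1 := by ring
      rw [convolve, this, convolve, ih (by simpa using hn)]

/-- One index more than in `convolve_shift`: the window ending at `n` then avoids `0`, where the
quasipolynomial and the counting series disagree. -/
theorem convolve_congr {q r : ℕ → ℚ} {l : List ℤ} {n : ℕ} (hn : l.length ≤ n)
    (h : ∀ t, 0 < t → q t = r t) : convolve q l n = convolve r l n := by
  induction l generalizing n with
  | nil => simp [convolve]
  | cons c l ih =>
    obtain ⟨n, rfl⟩ : ∃ m, n = m + 1 := ⟨n - 1, by simp only [List.length_cons] at hn; omega⟩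
    rw [convolve, convolve, ih (by simpa using hn), h _ n.succ_pos]

/-- The coefficients of the denominator. -/
def denCoeffs : List ℤ :=
  [1, 2, 3, 2, 0, -3, -6, -8, -9, -7, -3, 4, 10, 15, 16, 14, 8, 0, -8, -14, -16, -15, -10, -4, 3,
    7, 9, 8, 6, 3, 0, -2, -3, -2, -1]

/-- The coefficients of the numerator of the generating function of `L`. -/
def numLCoeffs : List ℤ :=
  [0, 0, 0, 0, 0, 0, 1, 3, 7, 15, 33, 65, 128, 208, 316, 434, 566, 676, 784, 852, 911, 936, 967,
    967, 1001, 995, 1000, 955, 893, 752, 624, 456, 322, 174, 79].map (12 * ·)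

/-- The coefficients of the numerator of the generating function of `hatL`. -/
def numHatLCoeffs : List ℤ :=
  [0, 0, 0, 0, 0, 0, 1, 3, 7, 13, 23, 37, 60, 86, 118, 149, 180, 199, 212, 208, 196, 171, 145,
    115, 96, 79, 72, 67, 66, 59, 54, 43, 33, 19, 9]

theorem den_eq_listSeries : den X = listSeries denCoeffs := by
  simp only [den, denCoeffs, listSeries]
  push_cast
  ring

theorem numL_eq_listSeries : 12 * X ^ 6 * numL X = listSeries numLCoeffs := by
  simp only [numL, numLCoeffs, List.map, listSeries]
  push_cast
  ring

theorem numHatL_eq_listSeries : X ^ 6 * numHatL X = listSeries numHatLCoeffs := by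
  simp only [numHatL, numHatLCoeffs, listSeries]
  push_cast
  ring

/-- The part of a constituent other than the correction term. -/
def bulk (c₄ c₃ : ℚ) (b₂ b₁ b₀ : ℕ → ℚ) (t : ℕ) : ℚ :=
  c₄ * (t : ℚ) ^ 4 - c₃ * (t : ℚ) ^ 3 + b₂ t * (t : ℚ) ^ 2 - b₁ t * (t : ℚ) + b₀ t

/-- Along each residue class modulo `p` this is a polynomial of degree at most 4, so its fifth
difference with step `p` vanishes. -/
theorem bulk_recurrence {c₄ c₃ : ℚ} {b₂ b₁ b₀ : ℕ → ℚ} {p : ℕ} (h₂ : ∀ t, b₂ (t + p) = b₂ t)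
    (h₁ : ∀ t, b₁ (t + p) = b₁ t) (h₀ : ∀ t, b₀ (t + p) = b₀ t) (t : ℕ) :
    bulk c₄ c₃ b₂ b₁ b₀ (t + p + p + p + p + p) =
      5 * bulk c₄ c₃ b₂ b₁ b₀ (t + p + p + p + p) - 10 * bulk c₄ c₃ b₂ b₁ b₀ (t + p + p + p) +
        10 * bulk c₄ c₃ b₂ b₁ b₀ (t + p + p) - 5 * bulk c₄ c₃ b₂ b₁ b₀ (t + p) +
        bulk c₄ c₃ b₂ b₁ b₀ t := by
  simp only [bulk, h₂, h₁, h₀]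
  push_cast
  ring

/-- Convolution with a fixed list inherits the recurrence of order `5 * p`, so `5 * p` consecutive
zeros force all later values to vanish. -/
theorem convolve_bulk {c₄ c₃ : ℚ} {b₂ b₁ b₀ : ℕ → ℚ} {p : ℕ} (hp : 0 < p)
    (h₂ : ∀ t, b₂ (t + p) = b₂ t) (h₁ : ∀ t, b₁ (t + p) = b₁ t) (h₀ : ∀ t, b₀ (t + p) = b₀ t)
    {l : List ℤ} {m : ℕ} (hl : l.length ≤ m + 1)
    (h : ∀ n < 5 * p, convolve (bulk c₄ c₃ b₂ b₁ b₀) l (n + m) = 0) (n : ℕ) :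
    convolve (bulk c₄ c₃ b₂ b₁ b₀) l (n + m) = 0 := by
  induction n using Nat.strong_induction_on with
  | _ n ih =>
    rcases lt_or_ge n (5 * p) with hn | hn
    · exact h n hn
    · obtain ⟨k, rfl⟩ := Nat.exists_eq_add_of_le' hn
      set B := bulk c₄ c₃ b₂ b₁ b₀ with hB
      have hrec : (fun t => B (t + 5 * p)) = fun t =>
          1 * (5 * B (t + 4 * p) + (-10) * B (t + 3 * p)) +
            1 * (1 * (10 * B (t + 2 * p) + (-5) * B (t + p)) + 1 * B t) := by
        funext t
        have := bulk_recurrence (c₄ := c₄) (c₃ := c₃) h₂ h₁ h₀ t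
        rw [show t + 5 * p = t + p + p + p + p + p by ring,
          show t + 4 * p = t + p + p + p + p by ring, show t + 3 * p = t + p + p + p by ring,
          show t + 2 * p = t + p + p by ring, hB, this]
        ring
      have hlk : l.length ≤ k + m + 1 := by omega
      have e : ∀ a, a < 5 * p → convolve B l (k + m + a) = 0 := fun a ha => by
        rw [add_right_comm]
        exact ih (k + a) (by omega)
      rw [add_right_comm, ← convolve_shift (5 * p) B hlk, hrec]
      simp only [convolve_linear]
      rw [convolve_shift _ B hlk, convolve_shift _ B hlk, convolve_shift _ B hlk,
        convolve_shift _ B hlk, e _ (by omega), e _ (by omega), e _ (by omega), e _ (by omega),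
        ← Nat.add_zero (k + m), e 0 (by omega)]
      norm_num

theorem S7_add (t : ℕ) : S7 (t + 21) = S7 t + 1 := by
  have : (((t + 21 : ℕ) : ℚ) - 1) / 21 = ((t : ℚ) - 1) / 21 + 1 := by
    push_cast
    ring
  rw [S7, S7, this, Int.floor_add_one, Nat.add_mod_right]
  ring

theorem convolve_S7 (n : ℕ) : convolve (fun t => (S7 t : ℚ)) denCoeffs (n + 34) = 0 := by
  induction n using Nat.strong_induction_on with
  | _ n ih =>
    rcases lt_or_ge n 21 with hn | hn
    · clear ih
      revert n
      decide +kernel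
    · obtain ⟨k, rfl⟩ := Nat.exists_eq_add_of_le' hn
      have hlen : denCoeffs.length ≤ k + 34 + 1 := by
        simp [denCoeffs]
      rw [add_right_comm, ← convolve_shift 21 (fun t => (S7 t : ℚ)) hlen]
      have hS : (fun t => ((S7 (t + 21) : ℤ) : ℚ)) = fun t => 1 * (S7 t : ℚ) + 1 * (fun _ => 1) t := by
        funext t
        rw [S7_add]
        push_cast
        ring
      -- The extra term is the convolution with the constant 1, that is, the sum of the coefficients
      -- of `den`. It is zero because `den` vanishes at 1.
      rw [hS, convolve_linear, ih k (by omega), add_comm k 34,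
        ← convolve_shift k (fun _ => (1 : ℚ)) (by decide)]
      decide +kernel

/-- Numerator and denominator both have degree at most 34. The coefficients of index below 35, whose
windows can reach `t = 0`, are compared directly with the value there set to 0; from 35 on, the bulk
and the `S7` part are annihilated separately. -/
theorem eq_of_genFun {f : ℕ → ℕ} {c₄ c₃ k : ℚ} {b₂ b₁ b₀ : ℕ → ℚ} {l : List ℤ}
    (hf : den X * genFun f = listSeries l) (hl : l.length = 35)
    (h₂ : ∀ t, b₂ (t + 120) = b₂ t) (h₁ : ∀ t, b₁ (t + 120) = b₁ t)
    (h₀ : ∀ t, b₀ (t + 120) = b₀ t)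
    (h : ∀ n < 600, convolve (bulk c₄ c₃ b₂ b₁ b₀) denCoeffs (n + 34) = 0)
    (hinit : ∀ n < 35, convolve (fun t => if t = 0 then 0 else bulk c₄ c₃ b₂ b₁ b₀ t - k * S7 t)
      denCoeffs n = (l.getD n 0 : ℤ)) {t : ℕ} (ht : 0 < t) :
    (f t : ℚ) = bulk c₄ c₃ b₂ b₁ b₀ t - k * S7 t := by
  have key : genFun f =
      PowerSeries.mk fun t => if t = 0 then 0 else bulk c₄ c₃ b₂ b₁ b₀ t - k * S7 t := by
    apply mul_left_cancel₀ den_ne_zero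
    rw [hf, den_eq_listSeries]
    ext n
    rw [coeff_listSeries_mul, coeff_listSeries]
    rcases lt_or_ge n 35 with hn | hn
    · exact (hinit n hn).symm
    · obtain ⟨m, rfl⟩ := Nat.exists_eq_add_of_le' (show 34 ≤ n by omega)
      rw [List.getD_eq_default _ _ (by omega), Int.cast_zero,
        convolve_congr (r := fun t => 1 * bulk c₄ c₃ b₂ b₁ b₀ t + (-k) * S7 t)
          (by simpa [denCoeffs] using hn) (fun t ht => by rw [if_neg ht.ne']; ring),
        convolve_linear, convolve_bulk (by decide : 0 < 120) h₂ h₁ h₀ (by simp [denCoeffs]) h,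
        convolve_S7]
      ring
  have := congrArg (coeff t) key
  simpa [genFun, ht.ne'] using this

theorem a2_add_six (t : ℕ) : a2 (t + 6) = a2 t := by simp [a2]
theorem hatA2_add_six (t : ℕ) : hatA2 (t + 6) = hatA2 t := by simp [hatA2]
theorem a1_add_twelve (t : ℕ) : a1 (t + 12) = a1 t := by simp [a1]
theorem hatA1_add_twelve (t : ℕ) : hatA1 (t + 12) = hatA1 t := by simp [hatA1]
theorem a0_add (t : ℕ) : a0 (t + 120) = a0 t := by simp [a0]
theorem hatA0_add (t : ℕ) : hatA0 (t + 120) = hatA0 t := by simp [hatA0]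

theorem convolve_bulk_L : ∀ n < 600, convolve (bulk (1 / 8) 3 a2 a1 a0) denCoeffs (n + 34) = 0 := by
  decide +kernel

theorem convolve_bulk_hatL : ∀ n < 600,
    convolve (bulk (1 / 576) (1 / 48) hatA2 hatA1 hatA0) denCoeffs (n + 34) = 0 := by
  decide +kernel

theorem L_eq {t : ℕ} (ht : 0 < t) : (L t : ℚ) = bulk (1 / 8) 3 a2 a1 a0 t - 72 * S7 t :=
  eq_of_genFun (den_mul_genFun_L.trans numL_eq_listSeries) rfl
    (Function.Periodic.nat_mul a2_add_six 20) (Function.Periodic.nat_mul a1_add_twelve 10) a0_add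
    convolve_bulk_L (by decide +kernel) ht

theorem hatL_eq_bulk {t : ℕ} (ht : 0 < t) :
    (hatL t : ℚ) = bulk (1 / 576) (1 / 48) hatA2 hatA1 hatA0 t - 1 * S7 t :=
  eq_of_genFun (den_mul_genFun_hatL.trans numHatL_eq_listSeries) rfl
    (Function.Periodic.nat_mul hatA2_add_six 20) (Function.Periodic.nat_mul hatA1_add_twelve 10)
    hatA0_add convolve_bulk_hatL (by decide +kernel) ht

end GeneratingFunctions

/-! ### Minimal periods and constituents -/

section Constituents

open Polynomial

/-- Two systems of constituents agree at infinitely many points of every residue class modulo `P *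
q`, hence as polynomials. The factor `k + 1` keeps these points positive. -/
theorem IsConstituents.periodic {f : ℕ → ℚ} {P q : ℕ} {M N : ℕ → ℚ[X]} (hP : 0 < P) (hq : 0 < q)
    (hM : IsConstituents f P M) (hN : IsConstituents f q N) :
    Function.Periodic (fun t => M (t % P)) q := by
  have key : ∀ t, M (t % P) = N (t % q) := fun t => by
    refine Polynomial.eq_of_infinite_eval_eq _ _
      (Set.infinite_of_injective_forall_mem (f := fun k : ℕ => ((t + P * (q * (k + 1)) : ℕ) : ℚ))
        (fun a b h => ?_) fun k => ?_)
    · simpa [hP.ne', hq.ne'] using Nat.cast_injective h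
    · have hpos : 0 < t + P * (q * (k + 1)) := by positivity
      have h1 := hM _ hpos
      have h2 := hN _ hpos
      rw [Nat.add_mul_mod_self_left] at h1
      rw [mul_left_comm, Nat.add_mul_mod_self_left, ← mul_left_comm] at h2
      exact h1.symm.trans h2
  intro t
  simp only [key, Nat.add_mod_right]

/-- Bézout modulo `P`: some multiple of `q` is congruent to the gcd. The strict inequality is needed
because a residue modulo `P` cannot equal `P`. -/
theorem periodic_gcd {α : Type*} {g : ℕ → α} {P q : ℕ} (hP : Function.Periodic g P)
    (hq : Function.Periodic g q) (h : q.gcd P < P) : Function.Periodic g (q.gcd P) := by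
  obtain ⟨a, -, ha⟩ := Nat.exists_mul_mod_eq_gcd h
  intro t
  have h1 : g (t + q.gcd P + q * a / P * P) = g (t + q.gcd P) := hP.nat_mul _ _
  have h2 : g (t + a * q) = g t := hq.nat_mul _ _
  rw [← h1, ← h2, ← ha, add_assoc, mul_comm a q, mul_comm (q * a / P), Nat.mod_add_div]

/-- A smaller number of constituents `q` would make the proper divisor `q.gcd P` of `P` a period.
Every proper divisor of `P` divides `P / r` for some prime `r`, so `P / r` would be a period too. -/
theorem hasPeriod_of_forall_prime {f : ℕ → ℚ} {P : ℕ} {M : ℕ → ℚ[X]} (hP : 0 < P)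
    (hM : IsConstituents f P M)
    (h : ∀ r ∈ P.primeFactors, ∃ t, M ((t + P / r) % P) ≠ M (t % P)) : HasPeriod f P := by
  refine ⟨⟨hP, M, hM⟩, ?_⟩
  rintro q ⟨hq, N, hN⟩
  by_contra! hlt
  have hgP : q.gcd P < P := (Nat.gcd_le_left P hq).trans_lt hlt
  have hg := periodic_gcd (g := fun t => M (t % P)) (fun t => by simp)
    (hM.periodic hP hq hN) hgP
  obtain ⟨c, hc⟩ := Nat.gcd_dvd_right q P
  set d := q.gcd P
  obtain ⟨r, hr, e, rfl⟩ := Nat.exists_prime_and_dvd (n := c) (by rintro rfl; omega)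
  have hdiv : P / r = e * d := by
    rw [hc]
    exact Nat.div_eq_of_eq_mul_right hr.pos (by ring)
  obtain ⟨t, ht⟩ := h r (Nat.mem_primeFactors.2 ⟨hr, ⟨d * e, by rw [hc]; ring⟩, hP.ne'⟩)
  rw [hdiv] at ht
  exact ht (hg.nat_mul e t)

theorem hasPeriod_of_periodic {a : ℕ → ℚ} {P : ℕ} (hP : 0 < P) (ha : Function.Periodic a P)
    (h : ∀ r ∈ P.primeFactors, ∃ t, a (t + P / r) ≠ a t) : HasPeriod a P := by
  refine hasPeriod_of_forall_prime (M := fun t => C (a t)) hP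
    (fun t _ => by rw [eval_C, ha.map_mod_nat]) fun r hr => ?_
  obtain ⟨t, ht⟩ := h r hr
  exact ⟨t, fun h => ht (by simpa [ha.map_mod_nat] using C_injective h)⟩

theorem primeFactors_values : Nat.primeFactors 6 = {2, 3} ∧ Nat.primeFactors 12 = {2, 3} ∧
    Nat.primeFactors 120 = {2, 3, 5} ∧ Nat.primeFactors 840 = {2, 3, 5, 7} := by
  decide +kernel

theorem hasPeriod_a2 : HasPeriod a2 6 :=
  hasPeriod_of_periodic (by decide) a2_add_six fun r hr => ⟨0, by
    rw [primeFactors_values.1] at hr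
    revert r
    decide +kernel⟩

theorem hasPeriod_hatA2 : HasPeriod hatA2 6 :=
  hasPeriod_of_periodic (by decide) hatA2_add_six fun r hr => ⟨0, by
    rw [primeFactors_values.1] at hr
    revert r
    decide +kernel⟩

theorem hasPeriod_a1 : HasPeriod a1 12 :=
  hasPeriod_of_periodic (by decide) a1_add_twelve fun r hr => ⟨0, by
    rw [primeFactors_values.2.1] at hr
    revert r
    decide +kernel⟩

theorem hasPeriod_hatA1 : HasPeriod hatA1 12 :=
  hasPeriod_of_periodic (by decide) hatA1_add_twelve fun r hr => ⟨0, by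
    rw [primeFactors_values.2.1] at hr
    revert r
    decide +kernel⟩

theorem hasPeriod_a0 : HasPeriod a0 120 :=
  hasPeriod_of_periodic (by decide) a0_add fun r hr => ⟨0, by
    rw [primeFactors_values.2.2.1] at hr
    revert r
    decide +kernel⟩

theorem hasPeriod_hatA0 : HasPeriod hatA0 120 :=
  hasPeriod_of_periodic (by decide) hatA0_add fun r hr => ⟨0, by
    rw [primeFactors_values.2.2.1] at hr
    revert r
    decide +kernel⟩

/-- The constituents of `bulk c₄ c₃ b₂ b₁ b₀ - k * S7`. -/
noncomputable def constituent (c₄ c₃ k : ℚ) (b₂ b₁ b₀ : ℕ → ℚ) (r : ℕ) : ℚ[X] :=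
  -- `S7 t` is `t / 21` minus a function of period 21. The linear part moves `k / 21` into the
  -- coefficient of `X`, the periodic part goes into the constant term, and the period becomes `lcm
  -- 120 21 = 840`.
  C c₄ * X ^ 4 - C c₃ * X ^ 3 + C (b₂ r) * X ^ 2 - C (b₁ r + k / 21) * X +
    C (b₀ r + k * ((r : ℚ) / 21 - S7 r))

theorem isConstituents_constituent {f : ℕ → ℚ} {c₄ c₃ k : ℚ} {b₂ b₁ b₀ : ℕ → ℚ}
    (h₂ : Function.Periodic b₂ 840) (h₁ : Function.Periodic b₁ 840) (h₀ : Function.Periodic b₀ 840)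
    (hf : ∀ t, 0 < t → f t = bulk c₄ c₃ b₂ b₁ b₀ t - k * S7 t) :
    IsConstituents f 840 (constituent c₄ c₃ k b₂ b₁ b₀) := by
  intro t ht
  have hS : Function.Periodic (fun t : ℕ => (t : ℚ) / 21 - S7 t) 21 := fun t => by
    simp only [S7_add]
    push_cast
    ring
  have hS' : ((t % 840 : ℕ) : ℚ) / 21 - S7 (t % 840) = (t : ℚ) / 21 - S7 t :=
    (hS.nat_mul 40).map_mod_nat t
  rw [hf t ht, constituent, bulk, hS', h₂.map_mod_nat, h₁.map_mod_nat, h₀.map_mod_nat]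
  simp only [eval_add, eval_sub, eval_mul, eval_C, eval_X, eval_pow]
  ring

theorem natDegree_constituent {c₄ : ℚ} (h : c₄ ≠ 0) (c₃ k : ℚ) (b₂ b₁ b₀ : ℕ → ℚ) (r : ℕ) :
    (constituent c₄ c₃ k b₂ b₁ b₀ r).natDegree = 4 := by
  unfold constituent
  compute_degree!

theorem hasPeriod_of_constituent {f : ℕ → ℚ} {c₄ c₃ k : ℚ} {b₂ b₁ b₀ : ℕ → ℚ}
    (hf : IsConstituents f 840 (constituent c₄ c₃ k b₂ b₁ b₀))
    (h : ∀ r ∈ ({2, 3, 5, 7} : Finset ℕ), b₀ (840 / r) + k * (((840 / r : ℕ) : ℚ) / 21 - S7 (840 / r)) ≠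
      b₀ 0 + k * (((0 : ℕ) : ℚ) / 21 - S7 0)) : HasPeriod f 840 := by
  refine hasPeriod_of_forall_prime (by decide) hf fun r hr => ⟨0, fun heq => ?_⟩
  rw [primeFactors_values.2.2.2] at hr
  refine h r hr ?_
  have hlt : 840 / r < 840 := Nat.div_lt_self (by decide) (by
    clear h heq hf
    revert r
    decide)
  rw [zero_add, Nat.mod_eq_of_lt hlt, Nat.zero_mod] at heq
  -- Evaluation at 0 compares constant terms, which already separate the constituents.
  simpa [constituent] using congrArg (eval 0) heq

theorem isConstituents_L : IsConstituents (fun t => (L t : ℚ)) 840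
    (constituent (1 / 8) 3 72 a2 a1 a0) :=
  isConstituents_constituent (Function.Periodic.nat_mul a2_add_six 140)
    (Function.Periodic.nat_mul a1_add_twelve 70) (Function.Periodic.nat_mul a0_add 7)
    fun _ => L_eq

theorem isConstituents_hatL : IsConstituents (fun t => (hatL t : ℚ)) 840
    (constituent (1 / 576) (1 / 48) 1 hatA2 hatA1 hatA0) :=
  isConstituents_constituent (Function.Periodic.nat_mul hatA2_add_six 140)
    (Function.Periodic.nat_mul hatA1_add_twelve 70) (Function.Periodic.nat_mul hatA0_add 7)
    fun _ => hatL_eq_bulk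

theorem S7_zero : S7 0 = -1 := by decide +kernel

end Constituents

end Magilatin

theorem mainTheorem6 :
    -- the generating function of the number of squares
    (Magilatin.genFun Magilatin.L =
        PowerSeries.X ^ 3 * (1 - PowerSeries.X ^ 3)⁻¹ * Magilatin.genFun Magilatin.R ∧
      Magilatin.genFun Magilatin.L =
        12 * PowerSeries.X ^ 6 * Magilatin.numL PowerSeries.X *
          (Magilatin.den PowerSeries.X)⁻¹) ∧
    -- the constituents of the number of squares
    (∀ t : ℕ, 0 < t →
      (Magilatin.L t : ℚ) =
        1 / 8 * (t : ℚ) ^ 4 - 3 * (t : ℚ) ^ 3 + Magilatin.a2 t * (t : ℚ) ^ 2 -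
          Magilatin.a1 t * (t : ℚ) + Magilatin.a0 t - 72 * (Magilatin.S7 t : ℚ)) ∧
    (Magilatin.HasPeriod Magilatin.a2 6 ∧ Magilatin.HasPeriod Magilatin.a1 12 ∧
      Magilatin.HasPeriod Magilatin.a0 120) ∧
    -- degree, period and principal constituent of the number of squares
    (Magilatin.HasPeriod (fun t => (Magilatin.L t : ℚ)) 840 ∧
      ∃ N : ℕ → Polynomial ℚ,
        Magilatin.IsConstituents (fun t => (Magilatin.L t : ℚ)) 840 N ∧
        (∀ r < 840, (N r).natDegree = 4) ∧
        N 0 = Polynomial.C (1 / 8) * Polynomial.X ^ 4 - Polynomial.C 3 * Polynomial.X ^ 3 +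
          Polynomial.C (151 / 4) * Polynomial.X ^ 2 -
          Polynomial.C (9192 / 35) * Polynomial.X + Polynomial.C 948) ∧
    -- the generating function of the number of symmetry types
    (Magilatin.genFun Magilatin.hatL =
        PowerSeries.X ^ 3 * (1 - PowerSeries.X ^ 3)⁻¹ * Magilatin.genFun Magilatin.hatR ∧
      Magilatin.genFun Magilatin.hatL =
        PowerSeries.X ^ 6 * Magilatin.numHatL PowerSeries.X *
          (Magilatin.den PowerSeries.X)⁻¹) ∧
    -- the constituents of the number of symmetry types
    (∀ t : ℕ, 0 < t →
      (Magilatin.hatL t : ℚ) =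
        1 / 576 * (t : ℚ) ^ 4 - 1 / 48 * (t : ℚ) ^ 3 + Magilatin.hatA2 t * (t : ℚ) ^ 2 -
          Magilatin.hatA1 t * (t : ℚ) + Magilatin.hatA0 t - (Magilatin.S7 t : ℚ)) ∧
    (Magilatin.HasPeriod Magilatin.hatA2 6 ∧ Magilatin.HasPeriod Magilatin.hatA1 12 ∧
      Magilatin.HasPeriod Magilatin.hatA0 120) ∧
    -- degree, period and principal constituent of the number of symmetry types
    (Magilatin.HasPeriod (fun t => (Magilatin.hatL t : ℚ)) 840 ∧
      ∃ N : ℕ → Polynomial ℚ,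
        Magilatin.IsConstituents (fun t => (Magilatin.hatL t : ℚ)) 840 N ∧
        (∀ r < 840, (N r).natDegree = 4) ∧
        N 0 = Polynomial.C (1 / 576) * Polynomial.X ^ 4 -
          Polynomial.C (1 / 48) * Polynomial.X ^ 3 +
          Polynomial.C (25 / 96) * Polynomial.X ^ 2 -
          Polynomial.C (74 / 35) * Polynomial.X + Polynomial.C 9) := by
  refine ⟨⟨Magilatin.genFun_L, ?_⟩, fun t ht => by rw [Magilatin.L_eq ht, Magilatin.bulk],
    ⟨Magilatin.hasPeriod_a2, Magilatin.hasPeriod_a1, Magilatin.hasPeriod_a0⟩,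
    ⟨Magilatin.hasPeriod_of_constituent Magilatin.isConstituents_L (by decide +kernel), _,
      Magilatin.isConstituents_L,
      fun r _ => Magilatin.natDegree_constituent (by norm_num) _ _ _ _ _ r, ?_⟩,
    ⟨Magilatin.genFun_hatL, ?_⟩, fun t ht => by rw [Magilatin.hatL_eq_bulk ht, Magilatin.bulk, one_mul],
    ⟨Magilatin.hasPeriod_hatA2, Magilatin.hasPeriod_hatA1, Magilatin.hasPeriod_hatA0⟩,
    ⟨Magilatin.hasPeriod_of_constituent Magilatin.isConstituents_hatL (by decide +kernel), _,
      Magilatin.isConstituents_hatL,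
      fun r _ => Magilatin.natDegree_constituent (by norm_num) _ _ _ _ _ r, ?_⟩⟩
  · rw [← Magilatin.den_mul_genFun_L, mul_right_comm, Magilatin.den_mul_inv, one_mul]
  -- Here `1296/5 + 72/21 = 9192/35`, and `S7 0 = -1` turns 876 into `876 + 72 = 948`.
  · norm_num [Magilatin.constituent, Magilatin.a2, Magilatin.a1, Magilatin.a0, Magilatin.a0Table,
      Magilatin.S7_zero]
  · rw [← Magilatin.den_mul_genFun_hatL, mul_right_comm, Magilatin.den_mul_inv, one_mul]
  · norm_num [Magilatin.constituent, Magilatin.hatA2, Magilatin.hatA1, Magilatin.hatA0,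
      Magilatin.hatA0Table, Magilatin.S7_zero]
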